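/- Let $b=(\sqrt5-1)/2$ and let $F:\mathbb R\to\mathbb R$ be the piecewise affine "connect-the-dots" map with dots at $(k,k-1)$ and $(k+b,k+b+1)$, $k\in\mathbb Z$ (linear interpolation between consecutive dots). Let $h:(0,1)\to\mathbb R$ be any homeomorphism, let $f:[0,1]\to[0,1]$ be given by $f=h^{-1}\circ F\circ h$ on $(0,1)$ and $f(0)=0$, $f(1)=1$, and let $P=\{0,1\}\cup\{h^{-1}(k),h^{-1}(k+b):k\in\mathbb Z\}$. Definitions. For $-\infty\le\alpha<\beta\le\infty$, a continuous map $g:[\alpha,\beta]\to[\alpha,\beta]$ is *countably piecewise monotone and Markov* with respect to a closed countable set $Q\subset[\alpha,\beta]$ with $\alpha,\beta\in Q$ if $g(Q)\subset Q$ and $g$ is monotone on each $Q$-basic interval, i.e. on each connected component of $[\alpha,\beta]\setminus Q$. It has *constant slope* $\lambda$ if, for some such $Q$, it is moreover affine with slope of absolute value $\lambda$ on each $Q$-basic interval. The transition matrix $T$ of $f$ is indexed by the $P$-basic intervals, with $T(I,J)=1$ if $f(I)\supseteq J$ and $T(I,J)=0$ otherwise. A nonnegative eigenvector of $T$ with eigenvalue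 $\lambda\in\mathbb R$ is a nonzero real vector $v=(v_I)$ with all $v_I\ge0$ and $\sum_J T(I,J)v_J=\lambda v_I$ for every $I$. Then: 1. $F$ has constant slope $2+\sqrt5$: for every $k\in\mathbb Z$, $F$ is affine with slope $2+\sqrt5$ on $[k,k+b]$ and affine with slope $-(2+\sqrt5)$ on $[k+b,k+1]$. 2. $f$ is continuous, countably piecewise monotone and Markov with respect to $P$. 3. $f$ is topologically mixing: for all nonempty open $U,V\subset[0,1]$ there is $n_0$ with $f^n(U)\cap V\ne\emptyset$ for all $n\ge n_0$. 4. For real $\lambda$, the matrix $T$ has a nonnegative eigenvector with eigenvalue $\lambda$ if and only if $\lambda\ge2+\sqrt5$; and every nonnegative eigenvector $v$ of $T$ is unsummable, $\sum_I v_I=\infty$. 5. For every $\lambda\ge2+\sqrt5$, $f$ is conjugate, via an increasing homeomorphism $\psi:[0,1]\to[-\infty,\infty]$, to a map of constant slope $\lambda$ on $[-\infty,\infty]$. 6. For every $\lambda>2+\sqrt5$ and every $a\in\mathbb R$, $f$ is conjugate, via increasing homeomorphisms, to a map of constant slope $\lambda$ on the extended half-line $[a,\infty]$ and to a map of constant slope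 $\lambda$ on the extended half-line $[-\infty,a]$. -/

import Mathlib

open Set

noncomputable section

namespace ConstantSlope

/-- The `P`-basic intervals: the connected components of the complement of `P`. -/
def basicIntervals {X : Type*} [TopologicalSpace X] (P : Set X) : Set (Set X) :=
  {I | ∃ x ∈ Pᶜ, I = connectedComponentIn Pᶜ x}

/-- `f` is a continuous, countably piecewise monotone and Markov self-map of `[a, b]`
with respect to the partition set `P`. -/
structure IsCPMM {α : Type*} [LinearOrder α] [TopologicalSpace α] {a b : α}
    (f : Icc a b → Icc a b) (P : Set (Icc a b)) : Prop where
  lt : a < b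
  continuous : Continuous f
  isClosed : IsClosed P
  countable : P.Countable
  endpoints_mem : ∀ x : Icc a b, (x : α) = a ∨ (x : α) = b → x ∈ P
  mapsTo : MapsTo f P P
  monotone : ∀ I ∈ basicIntervals P, MonotoneOn f I ∨ AntitoneOn f I

/-- The self-map `g` of `[a, b] ⊆ [-∞, ∞]` belongs to the class of continuous, countably piecewise
monotone and Markov maps, and it has constant slope `lam`: on each basic interval it is affine
with slope of absolute value `lam`. The endpoints `a, b` lie in the partition set, so that all
points of a basic interval are real numbers. -/
def HasConstantSlope {a b : EReal} (g : Icc a b → Icc a b) (lam : ℝ) : Prop :=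
  ∃ Q : Set (Icc a b), IsCPMM g Q ∧
    ∀ I ∈ basicIntervals Q, ∃ s c : ℝ, |s| = lam ∧
      ∀ x ∈ I, (g x : EReal) = ((s * (x : EReal).toReal + c : ℝ) : EReal)

/-- `f` is conjugate, via an increasing homeomorphism, to a map of constant slope `lam`
on `[a, b] ⊆ [-∞, ∞]`. -/
def IsConjugateToConstantSlope {X : Type*} [TopologicalSpace X] [Preorder X]
    (f : X → X) (a b : EReal) (lam : ℝ) : Prop :=
  ∃ (ψ : X ≃ₜ Icc a b) (g : Icc a b → Icc a b),
    StrictMono ψ ∧ (∀ x, ψ (f x) = g (ψ x)) ∧ HasConstantSlope g lam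

/-- Topological mixing. -/
def IsTopologicallyMixing {X : Type*} [TopologicalSpace X] (f : X → X) : Prop :=
  ∀ U V : Set X, IsOpen U → U.Nonempty → IsOpen V → V.Nonempty →
    ∃ n₀ : ℕ, ∀ n ≥ n₀, (f^[n] '' U ∩ V).Nonempty

open Classical in
/-- The binary transition matrix of `f` with respect to the partition set `P`. -/
def transitionMatrix {X : Type*} [TopologicalSpace X] (f : X → X) (P : Set X) :
    Matrix (basicIntervals P) (basicIntervals P) ℝ :=
  fun I J => if (J : Set X) ⊆ f '' (I : Set X) then 1 else 0

/-- `v` is a (nonzero) entrywise nonnegative eigenvector, with eigenvalue `lam`, of the possibly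
infinite matrix `T`; the series that define `T v` are required to converge. -/
structure IsNonnegEigenvector {ι : Type*} (T : Matrix ι ι ℝ) (lam : ℝ) (v : ι → ℝ) : Prop where
  ne_zero : v ≠ 0
  nonneg : ∀ i, 0 ≤ v i
  eigen : ∀ i, HasSum (fun j => T i j * v j) (lam * v i)

/-- The number `b = (√5 - 1) / 2`. -/
def dotB : ℝ := (√5 - 1) / 2

/-- The piecewise affine map which interpolates linearly between the consecutive dots
`(k, k - 1)`, `(k + b, k + b + 1)`, `(k + 1, k)`, for `k ∈ ℤ`. -/
def mapF (x : ℝ) : ℝ :=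
  if Int.fract x ≤ dotB then
    AffineMap.lineMap ((⌊x⌋ : ℝ) - 1) ((⌊x⌋ : ℝ) + dotB + 1) (Int.fract x / dotB)
  else
    AffineMap.lineMap ((⌊x⌋ : ℝ) + dotB + 1) (⌊x⌋ : ℝ) ((Int.fract x - dotB) / (1 - dotB))

open Classical in
/-- The self-map `h⁻¹ ∘ F ∘ h` of `(0, 1)`, with additional fixed points at `0` and `1`. -/
def mapf (h : Ioo (0 : ℝ) 1 ≃ₜ ℝ) (x : Icc (0 : ℝ) 1) : Icc (0 : ℝ) 1 :=
  if hx : (x : ℝ) ∈ Ioo (0 : ℝ) 1 then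
    ⟨h.symm (mapF (h ⟨x, hx⟩)), Ioo_subset_Icc_self (h.symm (mapF (h ⟨x, hx⟩))).2⟩
  else x

/-- The partition set `{0, 1} ∪ {h⁻¹(k), h⁻¹(k + b) : k ∈ ℤ}`. -/
def partitionP (h : Ioo (0 : ℝ) 1 ≃ₜ ℝ) : Set (Icc (0 : ℝ) 1) :=
  {x | (x : ℝ) = 0 ∨ (x : ℝ) = 1 ∨
    ∃ k : ℤ, (x : ℝ) = h.symm (k : ℝ) ∨ (x : ℝ) = h.symm ((k : ℝ) + dotB)}

end ConstantSlope

end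

namespace ConstantSlope

/-! ### The dots and the pieces of `F` -/

/-! The relation `b² = 1 - b` gives both kinds of piece the same expansion: `(b + 2) / b = (b + 1) /
(1 - b) = 2 + √5`. Number the dots in order. `F` moves even dots two places down and odd dots two
places up, satisfies `|F x - x| ≤ 1`, and commutes with the reflection `x ↦ b - x`.

Slope `λ` after a change of variable `φ` means that `φ ∘ F = ±λ φ + c` on each piece. At the dots
this is a linear system for `D j = φ (dot j)` (`IsDotSequence`), and the gaps `D (j + 1) - D j` then
form an eigenvector of the transition matrix. Eliminating the odd entries leaves `λ (x (k + 1) + x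
(k - 1)) = (λ² - 2λ - 1) x k`. It has a positive solution exactly when `λ² - 2λ - 1 ≥ 2λ`, that is,
`λ ≥ 2 + √5` (`even_recurrence`, `sqrt_five_le_of_recurrence`). Such solutions are convex, so they
cannot decay in both directions and are not summable.

For `λ > 2 + √5` there is a geometric solution of ratio `t ∈ (1, λ)`. A conjugacy with these values
at the dots is the fixed point of `pullback`, a contraction for the weight `t ^ x`
(`exists_hasSlope`). Its range is `(0, ∞)`; its reflection gives a lower half-line, and the sum of
the two gives the whole line. For `λ = 2 + √5` the identity serves.

Both strict monotonicity of `φ` and mixing rest on expansion: iterated images of any interval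
eventually cover a whole piece (`exists_piece_of_expanding`). -/

theorem dotB_sq : dotB * dotB = 1 - dotB := by
  have h : √5 * √5 = 5 := Real.mul_self_sqrt (by norm_num)
  unfold dotB
  linear_combination h / 4

theorem dotB_pos : 0 < dotB := by
  have : 1 < √5 := by
    rw [Real.lt_sqrt] <;> norm_num
  unfold dotB
  linarith

theorem dotB_lt_one : dotB < 1 := by
  have : √5 < 3 := by
    rw [Real.sqrt_lt'] <;> norm_num
  unfold dotB
  linarith

theorem two_lt_sqrt_five : 2 < √5 := by
  rw [Real.lt_sqrt] <;> norm_num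

theorem sqrt_five_eq : √5 = 2 * dotB + 1 := by
  unfold dotB
  ring

theorem mapF_left {k : ℤ} {x : ℝ} (hx : x ∈ Icc (k : ℝ) (k + dotB)) :
    mapF x = k - 1 + (2 + √5) * (x - k) := by
  have hf : ⌊x⌋ = k := by
    rw [Int.floor_eq_iff]
    exact ⟨hx.1, by linarith [hx.2, dotB_lt_one]⟩
  have hfr : Int.fract x = x - k := by rw [Int.fract, hf]
  have hb := dotB_pos.ne'
  rw [mapF, hfr, hf, if_pos (by linarith [hx.2]), AffineMap.lineMap_apply, sqrt_five_eq]
  simp only [vsub_eq_sub, vadd_eq_add, smul_eq_mul]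
  field_simp
  linear_combination (-(2 * (x - k))) * dotB_sq

theorem mapF_right {k : ℤ} {x : ℝ} (hx : x ∈ Icc ((k : ℝ) + dotB) (k + 1)) :
    mapF x = k + dotB + 1 - (2 + √5) * (x - (k + dotB)) := by
  have hb := dotB_pos
  have hb1 : 1 - dotB ≠ 0 := by linarith [dotB_lt_one]
  have hsq := dotB_sq
  -- At `x = k + dotB` the definition still takes its first branch, and at `x = k + 1` the floor has
  -- already jumped; both values come from `mapF_left`.
  rcases hx.1.eq_or_lt with h0 | h0
  · rw [mapF_left (k := k) (by rw [← h0]; constructor <;> linarith), ← h0, sqrt_five_eq]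
    linear_combination 2 * hsq
  rcases hx.2.eq_or_lt with h1 | h1
  · have := mapF_left (k := k + 1) (x := x) (by rw [h1]; push_cast; constructor <;> linarith)
    rw [this, h1, sqrt_five_eq]
    push_cast
    linear_combination (-2) * hsq
  have hf : ⌊x⌋ = k := by
    rw [Int.floor_eq_iff]
    exact ⟨by linarith, h1⟩
  have hfr : Int.fract x = x - k := by rw [Int.fract, hf]
  rw [mapF, hfr, hf, if_neg (by linarith), AffineMap.lineMap_apply, sqrt_five_eq]
  simp only [vsub_eq_sub, vadd_eq_add, smul_eq_mul]
  field_simp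
  linear_combination (-2 * (x - k - dotB)) * hsq

/-- The two-sided sequence whose even terms are `p` and whose odd terms are `q`. -/
noncomputable def interleave (p q : ℤ → ℝ) (j : ℤ) : ℝ :=
  if Even j then p (j / 2) else q (j / 2)

theorem interleave_even (p q : ℤ → ℝ) (k : ℤ) : interleave p q (2 * k) = p k := by
  simp [interleave]

theorem interleave_odd (p q : ℤ → ℝ) (k : ℤ) : interleave p q (2 * k + 1) = q k := by
  have h : (2 * k + 1) / 2 = k := by omega
  simp [interleave, h]

theorem interleave_strictMono {p q : ℤ → ℝ} (h₁ : ∀ k, p k < q k) (h₂ : ∀ k, q k < p (k + 1)) :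
    StrictMono (interleave p q) := by
  refine strictMono_int_of_lt_succ fun j => ?_
  obtain ⟨k, rfl | rfl⟩ := Int.even_or_odd' j
  · rw [interleave_even, interleave_odd]
    exact h₁ k
  · rw [show 2 * k + 1 + 1 = 2 * (k + 1) by ring, interleave_even, interleave_odd]
    exact h₂ k

/-- The dots, in increasing order. -/
noncomputable def dot : ℤ → ℝ := interleave (fun k => k) (fun k => k + dotB)

theorem dot_even (k : ℤ) : dot (2 * k) = k := interleave_even _ _ k

theorem dot_odd (k : ℤ) : dot (2 * k + 1) = k + dotB := interleave_odd _ _ k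

theorem dot_strictMono : StrictMono dot := by
  refine interleave_strictMono (fun k => ?_) (fun k => ?_)
  · linarith [dotB_pos]
  · push_cast
    linarith [dotB_lt_one]

/-- The action of `F` on the indices of the dots. -/
def dotMap (j : ℤ) : ℤ := if Even j then j - 2 else j + 2

theorem dotMap_even (k : ℤ) : dotMap (2 * k) = 2 * (k - 1) := by
  simp [dotMap]
  ring

theorem dotMap_odd (k : ℤ) : dotMap (2 * k + 1) = 2 * (k + 1) + 1 := by
  rw [dotMap, if_neg (by simp)]
  ring

/-- The sign of the slope of `F` to the right of a dot. -/
noncomputable def slopeSign (j : ℤ) : ℝ := if Even j then 1 else -1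

theorem slopeSign_even (k : ℤ) : slopeSign (2 * k) = 1 := by simp [slopeSign]

theorem slopeSign_odd (k : ℤ) : slopeSign (2 * k + 1) = -1 := by simp [slopeSign]

theorem slopeSign_mul_self (j : ℤ) : slopeSign j * slopeSign j = 1 := by
  unfold slopeSign
  split_ifs <;> norm_num

theorem abs_slopeSign (j : ℤ) : |slopeSign j| = 1 := by
  unfold slopeSign
  split_ifs <;> norm_num

theorem slopeSign_neg (j : ℤ) : slopeSign (-j) = slopeSign j := by
  simp [slopeSign]

theorem mapF_piece {j : ℤ} {x : ℝ} (hx : x ∈ Icc (dot j) (dot (j + 1))) :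
    mapF x = dot (dotMap j) + slopeSign j * (2 + √5) * (x - dot j) := by
  obtain ⟨k, rfl | rfl⟩ := Int.even_or_odd' j
  · rw [dot_even, dot_odd] at hx
    rw [mapF_left hx, dotMap_even, slopeSign_even, dot_even, dot_even]
    push_cast
    ring
  · rw [show 2 * k + 1 + 1 = 2 * (k + 1) by ring, dot_even, dot_odd] at hx
    push_cast at hx
    rw [mapF_right hx, dotMap_odd, slopeSign_odd, dot_odd, dot_odd]
    push_cast
    ring

theorem mapF_dot (j : ℤ) : mapF (dot j) = dot (dotMap j) := by
  rw [mapF_piece (j := j) ⟨le_rfl, (dot_strictMono (lt_add_one j)).le⟩]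
  ring

/-- The index of the piece that contains a point. -/
noncomputable def pieceIndex (x : ℝ) : ℤ :=
  if Int.fract x < dotB then 2 * ⌊x⌋ else 2 * ⌊x⌋ + 1

theorem mem_pieceIndex (x : ℝ) : x ∈ Ico (dot (pieceIndex x)) (dot (pieceIndex x + 1)) := by
  have h1 := Int.fract_add_floor x
  have h2 := Int.fract_nonneg x
  have h3 := Int.fract_lt_one x
  unfold pieceIndex
  split_ifs with h
  · rw [dot_even, dot_odd]
    constructor <;> linarith
  · rw [show 2 * ⌊x⌋ + 1 + 1 = 2 * (⌊x⌋ + 1) by ring, dot_even, dot_odd]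
    push_cast
    constructor <;> linarith

theorem mem_Icc_pieceIndex (x : ℝ) : x ∈ Icc (dot (pieceIndex x)) (dot (pieceIndex x + 1)) :=
  Ico_subset_Icc_self (mem_pieceIndex x)

theorem pieceIndex_eq {x : ℝ} {j : ℤ} (hx : x ∈ Ico (dot j) (dot (j + 1))) :
    pieceIndex x = j := by
  have h := mem_pieceIndex x
  have h1 := dot_strictMono.lt_iff_lt.1 (h.1.trans_lt hx.2)
  have h2 := dot_strictMono.lt_iff_lt.1 (hx.1.trans_lt h.2)
  omega

/-- Equality holds at the odd dots. This bound controls the weight `t ^ x` in `exists_hasSlope` and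
the continuity of `f` at the endpoints. -/
theorem mapF_le_add_one (x : ℝ) : mapF x ≤ x + 1 := by
  have hx := mem_Icc_pieceIndex x
  generalize pieceIndex x = j at hx
  have h5 := two_lt_sqrt_five
  obtain ⟨k, rfl | rfl⟩ := Int.even_or_odd' j
  · rw [dot_even, dot_odd] at hx
    rw [mapF_left hx, sqrt_five_eq]
    nlinarith [dotB_sq, hx.1, hx.2, dotB_pos]
  · rw [show 2 * k + 1 + 1 = 2 * (k + 1) by ring, dot_even, dot_odd] at hx
    push_cast at hx
    rw [mapF_right hx]
    nlinarith [hx.1, hx.2]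

theorem dot_reflect (j : ℤ) : dotB - dot j = dot (1 - j) := by
  obtain ⟨k, rfl | rfl⟩ := Int.even_or_odd' j
  · rw [show 1 - 2 * k = 2 * (-k) + 1 by ring, dot_even, dot_odd]
    push_cast
    ring
  · rw [show 1 - (2 * k + 1) = 2 * (-k) by ring, dot_even, dot_odd]
    push_cast
    ring

theorem mem_Icc_reflect {j : ℤ} {x : ℝ} (hx : x ∈ Icc (dot j) (dot (j + 1))) :
    dotB - x ∈ Icc (dot (-j)) (dot (-j + 1)) := by
  have h1 := dot_reflect j
  have h2 := dot_reflect (j + 1)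
  rw [show 1 - (j + 1) = -j by ring] at h2
  rw [show 1 - j = -j + 1 by ring] at h1
  constructor <;> linarith [hx.1, hx.2]

/-- The reflection exchanges the dots `j` and `1 - j`, hence the parities. This symmetry yields the
lower bound on `F`, the lower half-lines and the case of a decreasing `h`. -/
theorem mapF_reflect (x : ℝ) : mapF (dotB - x) = dotB - mapF x := by
  have hx := mem_Icc_pieceIndex x
  generalize pieceIndex x = j at hx
  rw [mapF_piece (mem_Icc_reflect hx), mapF_piece hx, slopeSign_neg]
  have h5 := sqrt_five_eq
  have hb := dotB_sq
  obtain ⟨k, rfl | rfl⟩ := Int.even_or_odd' j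
  · rw [show -(2 * k) = 2 * (-k) by ring, dotMap_even, dotMap_even, slopeSign_even, dot_even,
      dot_even, dot_even, dot_even, h5]
    push_cast
    linear_combination 2 * hb
  · rw [show -(2 * k + 1) = 2 * (-k - 1) + 1 by ring, dotMap_odd, dotMap_odd, slopeSign_odd,
      dot_odd, dot_odd, dot_odd, dot_odd, h5]
    push_cast
    linear_combination 2 * hb

theorem sub_one_le_mapF (x : ℝ) : x - 1 ≤ mapF x := by
  have h := mapF_le_add_one (dotB - x)
  rw [mapF_reflect] at h
  linarith

/-! ### Gluing along the pieces -/

theorem continuous_of_continuousOn_pieces {g : ℝ → ℝ}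
    (hg : ∀ j, ContinuousOn g (Icc (dot j) (dot (j + 1)))) : Continuous g := by
  refine LocallyFinite.continuous (f := fun j : ℤ => Icc (dot j) (dot (j + 1))) ?_ ?_
    (fun j => isClosed_Icc) hg
  · intro x
    -- Starting one dot further left gives a neighbourhood also when `x` is itself a dot.
    refine ⟨Ioo (dot (pieceIndex x - 1)) (dot (pieceIndex x + 1)),
      Ioo_mem_nhds ((dot_strictMono (by omega)).trans_le (mem_pieceIndex x).1)
        (mem_pieceIndex x).2, (finite_Icc (pieceIndex x - 2) (pieceIndex x + 1)).subset ?_⟩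
    rintro j ⟨y, hy, hy'⟩
    have h1 := dot_strictMono.lt_iff_lt.1 (hy.1.trans_lt hy'.2)
    have h2 := dot_strictMono.lt_iff_lt.1 (hy'.1.trans_le hy.2)
    constructor <;> omega
  · exact eq_univ_of_forall fun x => mem_iUnion.2 ⟨_, mem_Icc_pieceIndex x⟩

theorem monotone_of_monotoneOn_pieces {g : ℝ → ℝ}
    (hg : ∀ j, MonotoneOn g (Icc (dot j) (dot (j + 1)))) : Monotone g := by
  have hd : Monotone fun j => g (dot j) := monotone_int_of_le_succ fun j =>
    hg j (left_mem_Icc.2 (dot_strictMono (lt_add_one j)).le)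
      (right_mem_Icc.2 (dot_strictMono (lt_add_one j)).le) (dot_strictMono (lt_add_one j)).le
  intro x y hxy
  have hx := mem_Icc_pieceIndex x
  have hy := mem_Icc_pieceIndex y
  have hlt : dot (pieceIndex x) < dot (pieceIndex y + 1) :=
    (hx.1.trans hxy).trans_lt (mem_pieceIndex y).2
  rw [dot_strictMono.lt_iff_lt, Int.lt_add_one_iff] at hlt
  rcases hlt.eq_or_lt with h | h
  · rw [h] at hx
    exact hg _ hx hy hxy
  · calc g x ≤ g (dot (pieceIndex x + 1)) :=
          hg _ hx (right_mem_Icc.2 (hx.1.trans hx.2)) hx.2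
      _ ≤ g (dot (pieceIndex y)) := hd (by omega)
      _ ≤ g y := hg _ (left_mem_Icc.2 (hy.1.trans hy.2)) hy hy.1

theorem continuous_mapF : Continuous mapF :=
  continuous_of_continuousOn_pieces fun j =>
    ContinuousOn.congr (by fun_prop) fun _ hx => mapF_piece hx

/-- The function that agrees with `c j` on the piece between the dots `j` and `j + 1`. -/
noncomputable def glue (c : ℤ → ℝ → ℝ) (x : ℝ) : ℝ := c (pieceIndex x) x

/-- `pieceIndex` assigns a dot to the piece on its right, so the compatibility `hc` matters only at
the right endpoint. -/
theorem glue_eq {c : ℤ → ℝ → ℝ} (hc : ∀ j, c j (dot (j + 1)) = c (j + 1) (dot (j + 1)))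
    {j : ℤ} {x : ℝ} (hx : x ∈ Icc (dot j) (dot (j + 1))) : glue c x = c j x := by
  rcases hx.2.eq_or_lt with h | h
  · have : pieceIndex x = j + 1 := pieceIndex_eq (by
      rw [h]
      exact left_mem_Ico.2 (dot_strictMono (lt_add_one _)))
    rw [glue, this, h, hc]
  · rw [glue, pieceIndex_eq ⟨hx.1, h⟩]

/-! ### Expansion -/

theorem abs_mapF_sub {j : ℤ} {x y : ℝ} (hx : x ∈ Icc (dot j) (dot (j + 1)))
    (hy : y ∈ Icc (dot j) (dot (j + 1))) : |mapF x - mapF y| = (2 + √5) * |x - y| := by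
  rw [mapF_piece hx, mapF_piece hy, show dot (dotMap j) + slopeSign j * (2 + √5) * (x - dot j) -
    (dot (dotMap j) + slopeSign j * (2 + √5) * (y - dot j)) =
      slopeSign j * ((2 + √5) * (x - y)) by ring, abs_mul, abs_slopeSign, abs_mul,
    abs_of_pos (a := 2 + √5) (by positivity), one_mul]

/-- Each property of intervals that passes to subintervals and to the images, under `F`, of the
intervals in one piece holds for some piece as soon as it holds for some interval. -/
theorem exists_piece_of_expanding (Z : ℝ → ℝ → Prop)
    (hsub : ∀ p q p' q', Z p q → p ≤ p' → p' < q' → q' ≤ q → Z p' q')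
    (himg : ∀ p q j, Z p q → p < q → p ∈ Icc (dot j) (dot (j + 1)) →
      q ∈ Icc (dot j) (dot (j + 1)) → Z (min (mapF p) (mapF q)) (max (mapF p) (mapF q)))
    {p q : ℝ} (hpq : p < q) (hZ : Z p q) : ∃ j, Z (dot j) (dot (j + 1)) := by
  by_contra! hno
  have hdot := fun j : ℤ => dot_strictMono (lt_add_one j)
  -- An interval that contains no piece has at most one dot in its interior. The longer of the two
  -- parts has at least half the length, and `F` stretches it by `2 + √5 > 4`.
  have step : ∀ p q, p < q → Z p q → ∃ p' q', Z p' q' ∧ 2 * (q - p) ≤ q' - p' := by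
    have one : ∀ p q j, p < q → Z p q → p ∈ Icc (dot j) (dot (j + 1)) →
        q ∈ Icc (dot j) (dot (j + 1)) → ∃ p' q', Z p' q' ∧ 4 * (q - p) ≤ q' - p' := by
      intro p q j hpq hZ hp hq
      refine ⟨_, _, himg p q j hZ hpq hp hq, ?_⟩
      rw [max_sub_min_eq_abs, abs_mapF_sub hq hp, abs_of_pos (sub_pos.2 hpq)]
      nlinarith [two_lt_sqrt_five]
    intro p q hpq hZ
    have hp := mem_pieceIndex p
    generalize pieceIndex p = j at hp
    rcases le_or_gt q (dot (j + 1)) with h | h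
    · obtain ⟨p', q', h1, h2⟩ := one p q j hpq hZ ⟨hp.1, hp.2.le⟩ ⟨hp.1.trans hpq.le, h⟩
      exact ⟨p', q', h1, by linarith⟩
    rcases le_or_gt (dot (j + 1 + 1)) q with h' | h'
    · exact absurd (hsub _ _ _ _ hZ hp.2.le (hdot (j + 1)) h') (hno _)
    rcases le_total (q - dot (j + 1)) (dot (j + 1) - p) with h2 | h2
    · obtain ⟨p', q', h3, h4⟩ := one p _ j hp.2 (hsub _ _ _ _ hZ le_rfl hp.2 h.le)
        ⟨hp.1, hp.2.le⟩ ⟨(hdot j).le, le_rfl⟩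
      exact ⟨p', q', h3, by linarith⟩
    · obtain ⟨p', q', h3, h4⟩ := one _ q (j + 1) h (hsub _ _ _ _ hZ hp.2.le h le_rfl)
        ⟨le_rfl, (hdot (j + 1)).le⟩ ⟨h.le, h'.le⟩
      exact ⟨p', q', h3, by linarith⟩
  have iter : ∀ n : ℕ, ∃ p' q', Z p' q' ∧ 2 ^ n * (q - p) ≤ q' - p' := by
    intro n
    induction n with
    | zero => exact ⟨p, q, hZ, by simp⟩
    | succ n ih =>
      obtain ⟨p', q', h1, h2⟩ := ih
      have h3 : 0 < 2 ^ n * (q - p) := by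
        have := sub_pos.2 hpq
        positivity
      obtain ⟨p'', q'', h4, h5⟩ := step p' q' (by linarith) h1
      exact ⟨p'', q'', h4, by rw [pow_succ]; linarith⟩
  -- An interval longer than 2 contains the piece that starts at the first integer beyond its left
  -- end.
  obtain ⟨n, hn⟩ := pow_unbounded_of_one_lt (2 / (q - p)) (one_lt_two (α := ℝ))
  obtain ⟨p', q', h1, h2⟩ := iter n
  rw [div_lt_iff₀ (sub_pos.2 hpq)] at hn
  have h3 := Int.floor_le p'
  have h4 := Int.lt_floor_add_one p'
  refine hno _ (hsub _ _ _ _ h1 ?_ (hdot (2 * (⌊p'⌋ + 1))) ?_)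
  · rw [dot_even]
    push_cast
    exact h4.le
  · rw [dot_odd]
    push_cast
    linarith [dotB_lt_one]

/-! ### Conjugacies of `F` to maps of constant slope -/

/-- An increasing sequence of candidate images of the dots under a conjugacy of `F` to a map of
constant slope `lam`. -/
structure IsDotSequence (lam : ℝ) (D : ℤ → ℝ) : Prop where
  strictMono : StrictMono D
  eq : ∀ j, slopeSign j * lam * (D (j + 1) - D j) = D (dotMap (j + 1)) - D (dotMap j)

/-- On each piece, `φ ∘ F` is obtained from `φ` by an affine map of slope `± lam`. -/
def HasSlope (φ : ℝ → ℝ) (lam : ℝ) : Prop :=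
  ∀ j, ∃ c, ∀ x ∈ Icc (dot j) (dot (j + 1)), φ (mapF x) = slopeSign j * lam * φ x + c

theorem isDotSequence_dot : IsDotSequence (2 + √5) dot where
  strictMono := dot_strictMono
  eq j := by
    have h := mapF_piece (j := j) (right_mem_Icc.2 (dot_strictMono (lt_add_one j)).le)
    rw [mapF_dot] at h
    linear_combination -h

theorem hasSlope_id : HasSlope id (2 + √5) := fun j =>
  ⟨dot (dotMap j) - slopeSign j * (2 + √5) * dot j, fun x hx => by
    rw [id, id, mapF_piece hx]
    ring⟩

theorem HasSlope.reflect {φ : ℝ → ℝ} {lam : ℝ} (h : HasSlope φ lam) :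
    HasSlope (fun x => -φ (dotB - x)) lam := fun j => by
  obtain ⟨c, hc⟩ := h (-j)
  refine ⟨-c, fun x hx => ?_⟩
  have := hc _ (mem_Icc_reflect hx)
  rw [mapF_reflect, slopeSign_neg] at this
  simp only
  rw [this]
  ring

theorem HasSlope.add {φ χ : ℝ → ℝ} {lam : ℝ} (h : HasSlope φ lam) (h' : HasSlope χ lam) :
    HasSlope (fun x => φ x + χ x) lam := fun j => by
  obtain ⟨c, hc⟩ := h j
  obtain ⟨c', hc'⟩ := h' j
  refine ⟨c + c', fun x hx => ?_⟩
  simp only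
  rw [hc x hx, hc' x hx]
  ring

theorem HasSlope.add_const {φ : ℝ → ℝ} {lam : ℝ} (h : HasSlope φ lam) (a : ℝ) :
    HasSlope (fun x => φ x + a) lam := fun j => by
  obtain ⟨c, hc⟩ := h j
  refine ⟨c + a - slopeSign j * lam * a, fun x hx => ?_⟩
  simp only
  rw [hc x hx]
  ring

/-- The operator whose fixed points satisfy `HasSlope`. -/
noncomputable def pullback (lam : ℝ) (D : ℤ → ℝ) (φ : ℝ → ℝ) : ℝ → ℝ :=
  glue fun j x => D j + slopeSign j / lam * (φ (mapF x) - D (dotMap j))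

/-- A continuous monotone function with prescribed values at the dots. -/
structure Interpolates (D : ℤ → ℝ) (φ : ℝ → ℝ) : Prop where
  continuous : Continuous φ
  monotone : Monotone φ
  apply_dot : ∀ j, φ (dot j) = D j

/-! ### Fixed points of `pullback` -/

section

variable {lam : ℝ} {D : ℤ → ℝ} {φ : ℝ → ℝ}

/-- The equation of a dot sequence is exactly the agreement of neighbouring branches at their common
dot. -/
theorem pullback_apply (hlam : 0 < lam) (hD : IsDotSequence lam D)
    (hφ : ∀ j, φ (dot j) = D j) {j : ℤ} {x : ℝ} (hx : x ∈ Icc (dot j) (dot (j + 1))) :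
    pullback lam D φ x = D j + slopeSign j / lam * (φ (mapF x) - D (dotMap j)) := by
  refine glue_eq (fun i => ?_) hx
  rw [mapF_dot, hφ, ← hD.eq i]
  have := slopeSign_mul_self i
  field_simp
  linear_combination lam * (D (i + 1) - D i) * this

theorem slopeSign_mul_mapF_le {j : ℤ} {x y : ℝ} (hx : x ∈ Icc (dot j) (dot (j + 1)))
    (hy : y ∈ Icc (dot j) (dot (j + 1))) (hxy : x ≤ y) :
    slopeSign j * mapF x ≤ slopeSign j * mapF y := by
  rw [mapF_piece hx, mapF_piece hy]
  have h : 0 ≤ (slopeSign j * slopeSign j) * ((2 + √5) * (y - x)) := by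
    have := sub_nonneg.2 hxy
    rw [slopeSign_mul_self]
    positivity
  linarith

theorem slopeSign_mul_le_of_monotone (hφ : Monotone φ) {j : ℤ} {x y : ℝ}
    (h : slopeSign j * x ≤ slopeSign j * y) : slopeSign j * φ x ≤ slopeSign j * φ y := by
  unfold slopeSign at *
  split_ifs at * with hj
  · simpa using hφ (by linarith : x ≤ y)
  · simpa using hφ (by linarith : y ≤ x)

theorem Interpolates.pullback (hlam : 0 < lam) (hD : IsDotSequence lam D)
    (hφ : Interpolates D φ) : Interpolates D (pullback lam D φ) where
  continuous := continuous_of_continuousOn_pieces fun j => by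
    refine ContinuousOn.congr (Continuous.continuousOn ?_)
      fun _ hx => pullback_apply hlam hD hφ.apply_dot hx
    have := hφ.continuous
    have := continuous_mapF
    fun_prop
  monotone := monotone_of_monotoneOn_pieces fun j x hx y hy hxy => by
    rw [pullback_apply hlam hD hφ.apply_dot hx, pullback_apply hlam hD hφ.apply_dot hy]
    have := slopeSign_mul_le_of_monotone hφ.monotone (slopeSign_mul_mapF_le hx hy hxy)
    have := div_le_div_of_nonneg_right this hlam.le
    rw [mul_div_right_comm, mul_div_right_comm] at this
    linarith
  apply_dot j := by
    rw [pullback_apply hlam hD hφ.apply_dot (left_mem_Icc.2 (dot_strictMono (lt_add_one j)).le),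
      mapF_dot, hφ.apply_dot]
    ring

theorem exists_interpolates (hD : StrictMono D) : ∃ φ, Interpolates D φ := by
  have hpos := fun j : ℤ => sub_pos.2 (dot_strictMono (lt_add_one j))
  have heq : ∀ {j x}, x ∈ Icc (dot j) (dot (j + 1)) →
      glue (fun j x => D j + (D (j + 1) - D j) / (dot (j + 1) - dot j) * (x - dot j)) x =
        D j + (D (j + 1) - D j) / (dot (j + 1) - dot j) * (x - dot j) := fun hx =>
    glue_eq (fun i => by rw [div_mul_cancel₀ _ (hpos i).ne']; ring) hx
  refine ⟨glue fun j x => D j + (D (j + 1) - D j) / (dot (j + 1) - dot j) * (x - dot j),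
    continuous_of_continuousOn_pieces fun j =>
      ContinuousOn.congr (by fun_prop) fun _ hx => heq hx,
    monotone_of_monotoneOn_pieces fun j x hx y hy hxy => ?_, fun j => ?_⟩
  · rw [heq hx, heq hy]
    have := (hpos j).le
    have := (sub_pos.2 (hD (lt_add_one j))).le
    gcongr
  · rw [heq (left_mem_Icc.2 (dot_strictMono (lt_add_one j)).le)]
    ring

theorem Interpolates.mem_Icc (hφ : Interpolates D φ) {j : ℤ} {x : ℝ}
    (hx : x ∈ Icc (dot j) (dot (j + 1))) : φ x ∈ Icc (D j) (D (j + 1)) := by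
  rw [← hφ.apply_dot, ← hφ.apply_dot]
  exact ⟨hφ.monotone hx.1, hφ.monotone hx.2⟩

/-- If `φ` takes equal values at the ends of an interval within a piece, the slope relation gives
the same for its image under `F`. By expansion `φ` would be constant on a whole piece, contrary to
`hdot`. -/
theorem HasSlope.strictMono (hφ : Monotone φ) (h : HasSlope φ lam)
    (hdot : StrictMono fun j => φ (dot j)) : StrictMono φ := by
  intro p q hpq
  refine (hφ hpq.le).lt_of_ne fun hne => ?_
  have key : ∃ j, φ (dot j) = φ (dot (j + 1)) := by
    refine exists_piece_of_expanding (fun p q => φ p = φ q) ?_ ?_ hpq hne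
    · intro p q p' q' h1 h2 h3 h4
      exact le_antisymm (hφ h3.le) ((hφ h4).trans (h1.symm.le.trans (hφ h2)))
    · intro p q j h1 _ hp hq
      obtain ⟨c, hc⟩ := h j
      have h2 : φ (mapF p) = φ (mapF q) := by rw [hc p hp, hc q hq, h1]
      rcases le_total (mapF p) (mapF q) with h3 | h3
      · simp only [min_eq_left h3, max_eq_right h3, h2]
      · simp only [min_eq_right h3, max_eq_left h3, h2]
  obtain ⟨j, hj⟩ := key
  exact (hdot (lt_add_one j)).ne hj

/-- `pullback` divides differences by `lam` and evaluates them at `F x ≤ x + 1`, which costs at most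
a factor `t` in the weight `t ^ x`. Hence it contracts by `t / lam`, and its iterates converge to a
fixed point. Since all iterates have the values `D` at the dots, `hC` bounds the first difference.
-/
theorem exists_hasSlope {t C : ℝ} (ht : 1 ≤ t) (htl : t < lam) (hD : IsDotSequence lam D)
    (hC : ∀ j, ∀ x ∈ Icc (dot j) (dot (j + 1)), D (j + 1) - D j ≤ C * t ^ x) :
    ∃ φ : ℝ → ℝ, Continuous φ ∧ StrictMono φ ∧ (∀ j, φ (dot j) = D j) ∧ HasSlope φ lam := by
  have ht0 : 0 < t := by linarith
  have hlam : 0 < lam := by linarith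
  obtain ⟨φ₀, h₀⟩ := exists_interpolates hD.strictMono
  set u : ℕ → ℝ → ℝ := fun n => (pullback lam D)^[n] φ₀ with hu
  have hsucc : ∀ n, u (n + 1) = pullback lam D (u n) := fun n =>
    Function.iterate_succ_apply' _ _ _
  have hI : ∀ n, Interpolates D (u n) := by
    intro n
    induction n with
    | zero => exact h₀
    | succ n ih =>
      rw [hsucc]
      exact ih.pullback hlam hD
  have hr : t / lam < 1 := (div_lt_one hlam).2 htl
  have hdist : ∀ n x, dist (u n x) (u (n + 1) x) ≤ C * t ^ x * (t / lam) ^ n := by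
    intro n
    induction n with
    | zero =>
      intro x
      have hx := mem_Icc_pieceIndex x
      have h1 := (hI 0).mem_Icc hx
      have h2 := (hI 1).mem_Icc hx
      have h3 := hC _ x hx
      rw [pow_zero, mul_one, Real.dist_eq]
      refine le_trans (abs_sub_le_iff.2 ⟨?_, ?_⟩) h3 <;> linarith [h1.1, h1.2, h2.1, h2.2]
    | succ n ih =>
      intro x
      have hx := mem_Icc_pieceIndex x
      generalize pieceIndex x = j at hx
      have h1 := pullback_apply hlam hD (hI n).apply_dot hx
      have h2 := pullback_apply hlam hD (hI (n + 1)).apply_dot hx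
      rw [hsucc (n + 1), h2, hsucc n, h1, ← hsucc n, Real.dist_eq,
        show ∀ a b c d : ℝ, a + b * (c - d) - (a + b * (u (n + 1) (mapF x) - d)) =
          b * (c - u (n + 1) (mapF x)) by intros; ring, abs_mul, abs_div, abs_slopeSign,
        abs_of_pos hlam, ← Real.dist_eq]
      -- The sign of `C` is forced by `hC`, because the gaps of `D` are positive.
      have hC0 : 0 ≤ C := by
        have h3 := hC 0 _ (left_mem_Icc.2 (dot_strictMono (lt_add_one 0)).le)
        have h4 := hD.strictMono (lt_add_one 0)
        have h5 : 0 < C * t ^ (dot 0) := by linarith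
        exact (pos_of_mul_pos_left h5 (by positivity)).le
      have h3 : t ^ mapF x ≤ t ^ x * t := by
        rw [← Real.rpow_add_one ht0.ne']
        exact Real.rpow_le_rpow_of_exponent_le ht (mapF_le_add_one x)
      calc 1 / lam * dist (u n (mapF x)) (u (n + 1) (mapF x))
          ≤ 1 / lam * (C * (t ^ x * t) * (t / lam) ^ n) := by
            gcongr
            refine (ih _).trans ?_
            gcongr
        _ = C * t ^ x * (t / lam) ^ (n + 1) := by
            rw [pow_succ]
            field_simp
  have hlim : ∀ x, ∃ y, Filter.Tendsto (fun n => u n x) Filter.atTop (nhds y) := fun x =>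
    cauchySeq_tendsto_of_complete (cauchySeq_of_le_geometric _ _ hr fun n => hdist n x)
  choose φ hφ using hlim
  have hmono : Monotone φ := fun x y hxy =>
    le_of_tendsto_of_tendsto' (hφ x) (hφ y) fun n => (hI n).monotone hxy
  have hdots : ∀ j, φ (dot j) = D j := fun j =>
    tendsto_nhds_unique (hφ _) (tendsto_const_nhds.congr fun n => ((hI n).apply_dot j).symm)
  have hfix : ∀ j, ∀ x ∈ Icc (dot j) (dot (j + 1)),
      φ x = D j + slopeSign j / lam * (φ (mapF x) - D (dotMap j)) := fun j x hx =>
    tendsto_nhds_unique ((Filter.tendsto_add_atTop_iff_nat 1).2 (hφ x))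
      (((((hφ (mapF x)).sub_const _).const_mul _).const_add _).congr fun n => by
        rw [hsucc, pullback_apply hlam hD (hI n).apply_dot hx])
  have hslope : HasSlope φ lam := fun j =>
    ⟨D (dotMap j) - slopeSign j * lam * D j, fun x hx => by
      have h1 := hfix j x hx
      have h2 := slopeSign_mul_self j
      rw [h1]
      field_simp
      linear_combination (D (dotMap j) - φ (mapF x)) * h2⟩
  -- The error estimate is uniform in `x` only after division by the weight.
  have hcont : Continuous fun x => φ x / t ^ x := by
    refine TendstoUniformly.continuous (F := fun n x => u n x / t ^ x) (p := Filter.atTop) ?_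
      (Filter.Frequently.of_forall fun n => ?_)
    · have hz : Filter.Tendsto (fun n : ℕ => C * (t / lam) ^ n / (1 - t / lam))
          Filter.atTop (nhds 0) := by
        simpa using ((tendsto_pow_atTop_nhds_zero_of_lt_one (by positivity) hr).const_mul
          C).div_const (1 - t / lam)
      rw [Metric.tendstoUniformly_iff]
      intro ε hε
      filter_upwards [hz.eventually_lt_const hε] with n hn x
      have h1 := dist_le_of_le_geometric_of_tendsto _ _ hr (fun n => hdist n x) (hφ x) n
      have h2 : 0 < t ^ x := by positivity
      rw [dist_comm, Real.dist_eq, ← sub_div, abs_div, abs_of_pos h2, ← Real.dist_eq]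
      refine lt_of_le_of_lt ((div_le_iff₀ h2).2 (h1.trans_eq ?_)) hn
      ring
    · exact (hI n).continuous.div (by fun_prop (disch := positivity))
        fun x => (Real.rpow_pos_of_pos ht0 x).ne'
  have hpow : Continuous fun x : ℝ => t ^ x := Real.continuous_const_rpow ht0.ne'
  refine ⟨φ, (hcont.mul hpow).congr fun x => ?_, ?_, hdots, hslope⟩
  · exact div_mul_cancel₀ _ (Real.rpow_pos_of_pos ht0 x).ne'
  · refine hslope.strictMono hmono ?_
    simp only [hdots]
    exact hD.strictMono

end

/-- A solution `t > 1` of `t + 1 / t = lam - 2 - 1 / lam`. -/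
theorem exists_ratio {lam : ℝ} (h : 2 + √5 < lam) :
    ∃ t, 1 < t ∧ t < lam ∧ lam * (t * t + 1) = t * (lam * lam - 2 * lam - 1) := by
  have h5 : √5 * √5 = 5 := Real.mul_self_sqrt (by norm_num)
  have h2 := two_lt_sqrt_five
  have hlam : 0 < lam := by linarith
  obtain ⟨s, hs⟩ : ∃ s, s = lam - 2 - 1 / lam := ⟨_, rfl⟩
  have hsl : s * lam = lam * lam - 2 * lam - 1 := by
    rw [hs]
    field_simp
  -- Otherwise `lam² - 4 lam - 1 ≤ 0`, whose larger root is `2 + √5`.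
  have hs2 : 2 < s := by
    by_contra hle
    have : s * lam ≤ 2 * lam := by
      have := not_lt.1 hle
      gcongr
    nlinarith
  have hslam : s < lam := by
    have : 0 < 1 / lam := by positivity
    linarith
  have hr : √(s * s - 4) * √(s * s - 4) = s * s - 4 := Real.mul_self_sqrt (by nlinarith)
  have hr0 := Real.sqrt_nonneg (s * s - 4)
  set r := √(s * s - 4)
  -- This is the larger root of `t² - s t + 1 = 0`.
  refine ⟨(s + r) / 2, by linarith, ?_, ?_⟩
  · have : r < s := by nlinarith
    linarith
  · rw [← hsl]
    linear_combination (lam / 4) * hr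

/-- The dot sequence of the geometric eigenvector with ratio `t`. -/
noncomputable def geomDot (lam t : ℝ) : ℤ → ℝ :=
  interleave (fun k => t ^ k) (fun k => t ^ k * ((lam * t + 1) / (lam + t)))

theorem geomDot_even (lam t : ℝ) (k : ℤ) : geomDot lam t (2 * k) = t ^ k := interleave_even _ _ k

theorem geomDot_odd (lam t : ℝ) (k : ℤ) :
    geomDot lam t (2 * k + 1) = t ^ k * ((lam * t + 1) / (lam + t)) := interleave_odd _ _ k

section

variable {lam t : ℝ}

theorem geomDot_strictMono (hlam : 1 < lam) (ht : 1 < t) : StrictMono (geomDot lam t) := by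
  have hlt : 0 < lam + t := by linarith
  refine interleave_strictMono (fun k => ?_) (fun k => ?_)
  · have : 0 < t ^ k := by positivity
    rw [lt_mul_iff_one_lt_right this, one_lt_div hlt]
    nlinarith
  · have : 0 < t ^ k := by positivity
    rw [zpow_add_one₀ (by positivity)]
    gcongr
    rw [div_lt_iff₀ hlt]
    nlinarith

/-- The equations at odd indices determine the factor `(lam * t + 1) / (lam + t)`; those at even
indices then reduce to `h` multiplied by `t - 1`. -/
theorem isDotSequence_geomDot (hlam : 1 < lam) (ht : 1 < t)
    (h : lam * (t * t + 1) = t * (lam * lam - 2 * lam - 1)) :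
    IsDotSequence lam (geomDot lam t) where
  strictMono := geomDot_strictMono hlam ht
  eq j := by
    have hlt : lam + t ≠ 0 := by linarith
    have ht0 : t ≠ 0 := by linarith
    obtain ⟨k, rfl | rfl⟩ := Int.even_or_odd' j
    · rw [dotMap_even, dotMap_odd, slopeSign_even, geomDot_even, geomDot_even, geomDot_odd,
        geomDot_odd, zpow_add_one₀ ht0, zpow_sub_one₀ ht0]
      field_simp
      linear_combination (-(t - 1)) * h
    · rw [show 2 * k + 1 + 1 = 2 * (k + 1) by ring, dotMap_even, dotMap_odd, slopeSign_odd,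
        geomDot_even, geomDot_even, geomDot_odd, geomDot_odd, zpow_add_one₀ ht0,
        show k + 1 - 1 = k by ring]
      field_simp
      ring

theorem geomDot_sub_le (hlam : 1 < lam) (ht : 1 < t) {j : ℤ} {x : ℝ}
    (hx : x ∈ Icc (dot j) (dot (j + 1))) :
    geomDot lam t (j + 1) - geomDot lam t j ≤ t * t ^ x := by
  have ht0 : 0 < t := by linarith
  have hlt : 0 < lam + t := by linarith
  have key : ∀ k : ℤ, (k : ℝ) ≤ x → t ^ (k + 1) ≤ t * t ^ x := fun k hk => by
    rw [zpow_add_one₀ ht0.ne', mul_comm, ← Real.rpow_intCast]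
    gcongr
    exact ht.le
  have hmono := geomDot_strictMono hlam ht
  obtain ⟨k, rfl | rfl⟩ := Int.even_or_odd' j
  · rw [dot_even, dot_odd] at hx
    have h1 := hmono (lt_add_one (2 * k + 1))
    rw [show 2 * k + 1 + 1 = 2 * (k + 1) by ring, geomDot_even] at h1
    have h2 : 0 < t ^ k := by positivity
    rw [geomDot_even]
    linarith [key k hx.1]
  · rw [show 2 * k + 1 + 1 = 2 * (k + 1) by ring, dot_even, dot_odd] at hx
    rw [show 2 * k + 1 + 1 = 2 * (k + 1) by ring, geomDot_even, geomDot_odd]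
    have h2 : 0 < t ^ k * ((lam * t + 1) / (lam + t)) := by
      have : 0 < lam * t + 1 := by nlinarith
      positivity
    linarith [key k (by linarith [hx.1, dotB_pos])]

end

/-- For `lam > 2 + √5` there is a conjugacy of `F` to a map of constant slope `lam` on the positive
half-line. -/
theorem exists_hasSlope_pos {lam : ℝ} (h : 2 + √5 < lam) :
    ∃ φ : ℝ → ℝ, Continuous φ ∧ StrictMono φ ∧ HasSlope φ lam ∧ (∀ x, 0 < φ x) ∧
      ∀ y, 0 < y → ∃ x, φ x = y := by
  have hlam : 1 < lam := by linarith [two_lt_sqrt_five]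
  obtain ⟨t, ht, htl, hteq⟩ := exists_ratio h
  have ht0 : 0 < t := by linarith
  obtain ⟨φ, hc, hm, hdot, hs⟩ := exists_hasSlope ht.le htl (isDotSequence_geomDot hlam ht hteq)
    (C := t) fun j x hx => geomDot_sub_le hlam ht hx
  -- The values at the integers already show that `φ` is positive and comes arbitrarily close to `0`
  -- and `∞`.
  have hint : ∀ k : ℤ, φ k = t ^ k := fun k => by rw [← dot_even, hdot, geomDot_even]
  refine ⟨φ, hc, hm, hs, fun x => ?_, fun y hy => ?_⟩
  · have h1 := hm.monotone (Int.floor_le x)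
    rw [hint] at h1
    exact lt_of_lt_of_le (by positivity) h1
  · refine mem_range_of_exists_le_of_exists_ge hc ?_ ?_
    · obtain ⟨n, hn⟩ := exists_pow_lt_of_lt_one hy (inv_lt_one_of_one_lt₀ ht)
      refine ⟨((-n : ℤ) : ℝ), ?_⟩
      rw [hint, zpow_neg, zpow_natCast, ← inv_pow]
      exact hn.le
    · obtain ⟨n, hn⟩ := pow_unbounded_of_one_lt y ht
      refine ⟨((n : ℤ) : ℝ), ?_⟩
      rw [hint, zpow_natCast]
      exact hn.le

theorem strictMono_reflect {φ : ℝ → ℝ} (h : StrictMono φ) :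
    StrictMono fun x => -φ (dotB - x) := fun _ _ hxy =>
  neg_lt_neg (h (sub_lt_sub_left hxy _))

/-- For `lam ≥ 2 + √5` there is a conjugacy of `F` to a map of constant slope `lam` on the real
line. -/
theorem exists_hasSlope_real {lam : ℝ} (h : 2 + √5 ≤ lam) :
    ∃ φ : ℝ → ℝ, Continuous φ ∧ StrictMono φ ∧ HasSlope φ lam ∧ ∀ y, ∃ x, φ x = y := by
  rcases h.eq_or_lt with rfl | h
  · exact ⟨id, continuous_id, strictMono_id, hasSlope_id, fun y => ⟨y, rfl⟩⟩
  obtain ⟨φ, hc, hm, hs, hpos, hsurj⟩ := exists_hasSlope_pos h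
  have hc' : Continuous fun x => φ x + -φ (dotB - x) := by fun_prop
  -- The slope relation is additive. If `φ x = φ dotB + |y|`, then `x ≥ 0` and `φ (dotB - x) ≤ φ
  -- dotB`, so the sum is at least `|y|` at `x` and at most `-|y|` at `dotB - x`.
  refine ⟨fun x => φ x + -φ (dotB - x), hc', hm.add (strictMono_reflect hm),
    hs.add hs.reflect, fun y => mem_range_of_exists_le_of_exists_ge hc' ?_ ?_⟩
  · obtain ⟨x, hx⟩ := hsurj (φ dotB + |y|) (by have := hpos dotB; positivity)
    refine ⟨dotB - x, ?_⟩
    have h0 : 0 ≤ x := hm.le_iff_le.1 (by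
      rw [hx]
      linarith [hm dotB_pos, abs_nonneg y])
    have h1 := hm.monotone (sub_le_self dotB h0)
    simp only [sub_sub_cancel, hx]
    linarith [neg_abs_le y]
  · obtain ⟨x, hx⟩ := hsurj (φ dotB + |y|) (by have := hpos dotB; positivity)
    refine ⟨x, ?_⟩
    have h0 : 0 ≤ x := hm.le_iff_le.1 (by
      rw [hx]
      linarith [hm dotB_pos, abs_nonneg y])
    have h1 := hm.monotone (sub_le_self dotB h0)
    simp only [hx]
    linarith [le_abs_self y]

/-! ### Basic intervals -/

/-- Each `J i` and the union of the others are disjoint open sets covering `Pᶜ`, so a connected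
subset of `Pᶜ` that meets `J i` stays inside it. -/
theorem basicIntervals_eq_range {X ι : Type*} [TopologicalSpace X] {P : Set X} {J : ι → Set X}
    (hopen : ∀ i, IsOpen (J i)) (hconn : ∀ i, IsPreconnected (J i)) (hne : ∀ i, (J i).Nonempty)
    (hdisj : ∀ i j, i ≠ j → Disjoint (J i) (J j)) (hP : Pᶜ = ⋃ i, J i) :
    basicIntervals P = range J := by
  have key : ∀ i, ∀ x ∈ J i, connectedComponentIn Pᶜ x = J i := by
    intro i x hx
    have hsub : J i ⊆ Pᶜ := hP ▸ subset_iUnion J i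
    refine Subset.antisymm ?_ ((hconn i).subset_connectedComponentIn hx hsub)
    refine isPreconnected_connectedComponentIn.subset_left_of_subset_union (hopen i)
      (isOpen_iUnion fun j : {j // j ≠ i} => hopen j) ?_ ?_
      ⟨x, mem_connectedComponentIn (hsub hx), hx⟩
    · exact disjoint_iUnion_right.2 fun j => hdisj _ _ j.2.symm
    · refine (connectedComponentIn_subset _ _).trans fun y hy => ?_
      rw [hP] at hy
      obtain ⟨j, hj⟩ := mem_iUnion.1 hy
      by_cases hji : j = i
      · exact Or.inl (hji ▸ hj)
      · exact Or.inr (mem_iUnion.2 ⟨⟨j, hji⟩, hj⟩)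
  ext I
  constructor
  · rintro ⟨x, hx, rfl⟩
    rw [hP] at hx
    obtain ⟨i, hi⟩ := mem_iUnion.1 hx
    exact ⟨i, (key i x hi).symm⟩
  · rintro ⟨i, rfl⟩
    obtain ⟨x, hx⟩ := hne i
    exact ⟨x, hP ▸ mem_iUnion.2 ⟨i, hx⟩, (key i x hx).symm⟩

theorem exists_of_mem_basicIntervals_image {X Y : Type*} [TopologicalSpace X] [TopologicalSpace Y]
    (e : X ≃ₜ Y) {P : Set X} {I : Set Y} (hI : I ∈ basicIntervals (e '' P)) :
    ∃ I' ∈ basicIntervals P, I = e '' I' := by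
  obtain ⟨y, hy, rfl⟩ := hI
  have hcompl : (e '' P)ᶜ = e '' Pᶜ := (image_compl_eq e.bijective).symm
  obtain ⟨x, rfl⟩ := e.surjective y
  rw [hcompl] at hy ⊢
  have hx : x ∈ Pᶜ := (e.injective.mem_set_image).1 hy
  exact ⟨_, ⟨x, hx, rfl⟩, (e.image_connectedComponentIn hx).symm⟩

theorem IsCPMM.conj {α β : Type*} [LinearOrder α] [TopologicalSpace α] [LinearOrder β]
    [TopologicalSpace β] {a b : α} {a' b' : β} {f : Icc a b → Icc a b} {P : Set (Icc a b)}
    (hf : IsCPMM f P) (ψ : Icc a b ≃ₜ Icc a' b') (hψ : StrictMono ψ) :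
    IsCPMM (fun y => ψ (f (ψ.symm y))) (ψ '' P) where
  lt := by
    have h : ψ ⟨a, left_mem_Icc.2 hf.lt.le⟩ < ψ ⟨b, right_mem_Icc.2 hf.lt.le⟩ := hψ hf.lt
    exact (ψ _).2.1.trans_lt ((Subtype.coe_lt_coe.2 h).trans_le (ψ _).2.2)
  continuous := ψ.continuous.comp (hf.continuous.comp ψ.symm.continuous)
  isClosed := ψ.isClosedMap _ hf.isClosed
  countable := hf.countable.image _
  endpoints_mem y hy := by
    rcases hy with hy | hy
    · refine ⟨⟨a, left_mem_Icc.2 hf.lt.le⟩, hf.endpoints_mem _ (Or.inl rfl), le_antisymm ?_ ?_⟩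
      · obtain ⟨x, rfl⟩ := ψ.surjective y
        exact hψ.monotone x.2.1
      · exact Subtype.coe_le_coe.1 (hy.le.trans (ψ _).2.1)
    · refine ⟨⟨b, right_mem_Icc.2 hf.lt.le⟩, hf.endpoints_mem _ (Or.inr rfl), le_antisymm ?_ ?_⟩
      · exact Subtype.coe_le_coe.1 ((ψ _).2.2.trans hy.ge)
      · obtain ⟨x, rfl⟩ := ψ.surjective y
        exact hψ.monotone x.2.2
  mapsTo := by
    rintro _ ⟨x, hx, rfl⟩
    simp only [ψ.symm_apply_apply]
    exact mem_image_of_mem _ (hf.mapsTo hx)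
  monotone I hI := by
    obtain ⟨I', hI', rfl⟩ := exists_of_mem_basicIntervals_image ψ hI
    refine (hf.monotone I' hI').imp (fun h => ?_) (fun h => ?_) <;>
    · rintro _ ⟨x, hx, rfl⟩ _ ⟨y, hy, rfl⟩ hxy
      simp only [ψ.symm_apply_apply]
      exact hψ.monotone (h hx hy (hψ.le_iff_le.1 hxy))

/-! ### The interval map -/

section

variable (h : Ioo (0 : ℝ) 1 ≃ₜ ℝ)

/-- The parametrization of the interior of `[0, 1]` by the real line. -/
noncomputable def param (y : ℝ) : Icc (0 : ℝ) 1 := ⟨h.symm y, Ioo_subset_Icc_self (h.symm y).2⟩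

theorem mapf_param (y : ℝ) : mapf h (param h y) = param h (mapF y) := by
  have : ((param h y : Icc (0 : ℝ) 1) : ℝ) ∈ Ioo (0 : ℝ) 1 := (h.symm y).2
  rw [mapf, dif_pos this]
  simp [param]

theorem mapf_zero : mapf h 0 = 0 := by simp [mapf]

theorem mapf_one : mapf h 1 = 1 := by simp [mapf]

theorem eq_zero_or_one_or_param (x : Icc (0 : ℝ) 1) : x = 0 ∨ x = 1 ∨ ∃ y, x = param h y := by
  rcases x.2.1.eq_or_lt with h0 | h0
  · exact Or.inl (Subtype.ext h0.symm)
  rcases x.2.2.eq_or_lt with h1 | h1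
  · exact Or.inr (Or.inl (Subtype.ext h1))
  · exact Or.inr (Or.inr ⟨h ⟨x, h0, h1⟩, by simp [param]⟩)

theorem param_pos (y : ℝ) : 0 < param h y := (h.symm y).2.1

theorem param_lt_one (y : ℝ) : param h y < 1 := (h.symm y).2.2

theorem continuous_param : Continuous (param h) :=
  (continuous_subtype_val.comp h.symm.continuous).subtype_mk _

theorem param_injective : Function.Injective (param h) := fun x y hxy =>
  by
  have hval : (param h x : ℝ) = param h y := by rw [hxy]
  exact h.symm.injective (Subtype.ext hval)

theorem isOpenEmbedding_param : Topology.IsOpenEmbedding (param h) := by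
  refine .of_continuous_injective_isOpenMap (continuous_param h) (param_injective h) fun U hU => ?_
  have h1 : IsOpen (Subtype.val '' (h.symm '' U) : Set ℝ) :=
    isOpen_Ioo.isOpenMap_subtype_val _ (h.symm.isOpenMap _ hU)
  convert h1.preimage (continuous_subtype_val (p := (· ∈ Icc (0 : ℝ) 1))) using 1
  ext x
  constructor
  · rintro ⟨y, hy, rfl⟩
    exact ⟨_, mem_image_of_mem _ hy, rfl⟩
  · rintro ⟨_, ⟨y, hy, rfl⟩, hyx⟩
    exact ⟨y, hy, Subtype.ext hyx⟩

theorem mem_partitionP_iff (x : Icc (0 : ℝ) 1) :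
    x ∈ partitionP h ↔ x = 0 ∨ x = 1 ∨ ∃ j, x = param h (dot j) := by
  have h0 : (x : ℝ) = 0 ↔ x = 0 := ⟨fun h => Subtype.ext h, fun h => by simp [h]⟩
  have h1 : (x : ℝ) = 1 ↔ x = 1 := ⟨fun h => Subtype.ext h, fun h => by simp [h]⟩
  rw [partitionP, mem_ofPred_eq, h0, h1]
  refine or_congr_right (or_congr_right ⟨?_, ?_⟩)
  · rintro ⟨k, hk | hk⟩
    · exact ⟨2 * k, Subtype.ext (by rw [hk, dot_even]; rfl)⟩
    · exact ⟨2 * k + 1, Subtype.ext (by rw [hk, dot_odd]; rfl)⟩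
  · rintro ⟨j, rfl⟩
    obtain ⟨k, rfl | rfl⟩ := Int.even_or_odd' j
    · exact ⟨k, Or.inl (by rw [dot_even]; rfl)⟩
    · exact ⟨k, Or.inr (by rw [dot_odd]; rfl)⟩

/-- The basic intervals, in order. -/
def cell (j : ℤ) : Set (Icc (0 : ℝ) 1) := param h '' Ioo (dot j) (dot (j + 1))

theorem isOpen_cell (j : ℤ) : IsOpen (cell h j) := (isOpenEmbedding_param h).isOpenMap _ isOpen_Ioo

theorem cell_nonempty (j : ℤ) : (cell h j).Nonempty :=
  (nonempty_Ioo.2 (dot_strictMono (lt_add_one j))).image _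

theorem disjoint_cell {i j : ℤ} (hij : i ≠ j) : Disjoint (cell h i) (cell h j) := by
  refine (disjoint_image_iff (param_injective h)).2 (disjoint_left.2 fun y hi hj => hij ?_)
  rw [← pieceIndex_eq (Ioo_subset_Ico_self hi), pieceIndex_eq (Ioo_subset_Ico_self hj)]

theorem compl_partitionP : (partitionP h)ᶜ = ⋃ j, cell h j := by
  ext x
  rw [mem_compl_iff, mem_partitionP_iff, mem_iUnion]
  constructor
  · intro hx
    push Not at hx
    obtain ⟨y, rfl⟩ := ((eq_zero_or_one_or_param h x).resolve_left hx.1).resolve_left hx.2.1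
    have hy := mem_pieceIndex y
    exact ⟨_, y, ⟨hy.1.lt_of_ne fun he => hx.2.2 _ (by rw [he]), hy.2⟩, rfl⟩
  · rintro ⟨j, y, hy, rfl⟩ (h0 | h1 | ⟨i, hi⟩)
    · exact (param_pos h y).ne' h0
    · exact (param_lt_one h y).ne h1
    · rw [param_injective h hi, mem_Ioo, dot_strictMono.lt_iff_lt, dot_strictMono.lt_iff_lt] at hy
      omega

theorem basicIntervals_partitionP : basicIntervals (partitionP h) = range (cell h) :=
  basicIntervals_eq_range (isOpen_cell h)
    (fun _ => isPreconnected_Ioo.image _ (continuous_param h).continuousOn) (cell_nonempty h)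
    (fun _ _ => disjoint_cell h) (compl_partitionP h)

variable {h}

theorem param_strictMono (hm : StrictMono h.symm) : StrictMono (param h) := fun _ _ hxy => hm hxy

variable (h) in
theorem exists_param_le {x : Icc (0 : ℝ) 1} (hx : 0 < x) :
    ∃ y, param h y ≤ x := by
  rcases eq_zero_or_one_or_param h x with rfl | rfl | ⟨y, rfl⟩
  · exact absurd hx (lt_irrefl _)
  · exact ⟨0, (param_lt_one h 0).le⟩
  · exact ⟨y, le_rfl⟩

variable (h) in
theorem exists_le_param {x : Icc (0 : ℝ) 1} (hx : x < 1) :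
    ∃ y, x ≤ param h y := by
  rcases eq_zero_or_one_or_param h x with rfl | rfl | ⟨y, rfl⟩
  · exact ⟨0, (param_pos h 0).le⟩
  · exact absurd hx (lt_irrefl _)
  · exact ⟨y, le_rfl⟩

/-- At `0` and `1` continuity follows from `x - 1 ≤ F x ≤ x + 1`: points near an end of the line
stay near that end. -/
theorem continuous_mapf (hm : StrictMono h.symm) : Continuous (mapf h) := by
  have hp := param_strictMono hm
  rw [continuous_iff_continuousAt]
  intro x
  rcases eq_zero_or_one_or_param h x with rfl | rfl | ⟨y, rfl⟩
  · rw [ContinuousAt, mapf_zero, tendsto_order]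
    refine ⟨fun a ha => absurd (show (0 : Icc (0 : ℝ) 1) ≤ a from a.2.1) (not_le.2 ha),
      fun a ha => ?_⟩
    obtain ⟨y, hy⟩ := exists_param_le h ha
    filter_upwards [Iio_mem_nhds (param_pos h (y - 1))] with x hx
    rcases eq_zero_or_one_or_param h x with rfl | rfl | ⟨z, rfl⟩
    · rwa [mapf_zero]
    · exact absurd hx (not_lt.2 (param_lt_one h _).le)
    · rw [mapf_param]
      refine (hp ?_).trans_le hy
      linarith [hp.lt_iff_lt.1 hx, mapF_le_add_one z]
  · rw [ContinuousAt, mapf_one, tendsto_order]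
    refine ⟨fun a ha => ?_,
      fun a ha => absurd (show a ≤ (1 : Icc (0 : ℝ) 1) from a.2.2) (not_le.2 ha)⟩
    obtain ⟨y, hy⟩ := exists_le_param h ha
    filter_upwards [Ioi_mem_nhds (param_lt_one h (y + 1))] with x hx
    rcases eq_zero_or_one_or_param h x with rfl | rfl | ⟨z, rfl⟩
    · exact absurd hx (not_lt.2 (param_pos h _).le)
    · rwa [mapf_one]
    · rw [mapf_param]
      refine hy.trans_lt (hp ?_)
      linarith [hp.lt_iff_lt.1 hx, sub_one_le_mapF z]
  · rw [← (isOpenEmbedding_param h).continuousAt_iff]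
    have : mapf h ∘ param h = param h ∘ mapF := funext (mapf_param h)
    rw [this]
    exact ((continuous_param h).comp continuous_mapF).continuousAt

theorem isCPMM_mapf (hm : StrictMono h.symm) : IsCPMM (mapf h) (partitionP h) where
  lt := zero_lt_one
  continuous := continuous_mapf hm
  isClosed := by
    rw [← isOpen_compl_iff, compl_partitionP]
    exact isOpen_iUnion (isOpen_cell h)
  countable := by
    refine Countable.mono (s₂ := {0, 1} ∪ range fun j => param h (dot j)) (fun x hx => ?_)
      ((toFinite _).countable.union (countable_range _))
    rcases (mem_partitionP_iff h x).1 hx with hx | hx | ⟨j, hj⟩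
    · exact Or.inl (Or.inl hx)
    · exact Or.inl (Or.inr hx)
    · exact Or.inr ⟨j, hj.symm⟩
  endpoints_mem x hx := by
    rcases hx with hx | hx
    · exact Or.inl hx
    · exact Or.inr (Or.inl hx)
  mapsTo x hx := by
    rw [mem_partitionP_iff] at hx ⊢
    rcases hx with rfl | rfl | ⟨j, rfl⟩
    · exact Or.inl (mapf_zero h)
    · exact Or.inr (Or.inl (mapf_one h))
    · exact Or.inr (Or.inr ⟨dotMap j, by rw [mapf_param, mapF_dot]⟩)
  monotone I hI := by
    rw [basicIntervals_partitionP] at hI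
    obtain ⟨j, rfl⟩ := hI
    have hp := param_strictMono hm
    have key : ∀ x ∈ Ioo (dot j) (dot (j + 1)), ∀ y ∈ Ioo (dot j) (dot (j + 1)),
        param h x ≤ param h y → slopeSign j * mapF x ≤ slopeSign j * mapF y :=
      fun x hx y hy hxy => slopeSign_mul_mapF_le (Ioo_subset_Icc_self hx) (Ioo_subset_Icc_self hy)
        (hp.le_iff_le.1 hxy)
    unfold slopeSign at key
    split_ifs at key with hj
    · left
      rintro _ ⟨x, hx, rfl⟩ _ ⟨y, hy, rfl⟩ hxy
      rw [mapf_param, mapf_param]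
      exact hp.monotone (by linarith [key x hx y hy hxy])
    · right
      rintro _ ⟨x, hx, rfl⟩ _ ⟨y, hy, rfl⟩ hxy
      rw [mapf_param, mapf_param]
      exact hp.monotone (by linarith [key x hx y hy hxy])

/-! ### Mixing -/

/-- One of `a`, `a + 1` is even and moves down two places; one of `b - 1`, `b` is odd and moves up
two places. The image thus gains a dot on each side, and connectedness fills in the rest. -/
theorem Icc_dot_subset_image {a b : ℤ} (hab : a < b) :
    Icc (dot (a - 1)) (dot (b + 1)) ⊆ mapF '' Icc (dot a) (dot b) := by
  have hpre : IsPreconnected (mapF '' Icc (dot a) (dot b)) :=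
    isPreconnected_Icc.image _ continuous_mapF.continuousOn
  have hmem : ∀ j, a ≤ j → j ≤ b → dot (dotMap j) ∈ mapF '' Icc (dot a) (dot b) := fun j h1 h2 =>
    ⟨dot j, ⟨dot_strictMono.monotone h1, dot_strictMono.monotone h2⟩, mapF_dot j⟩
  have hlow : ∃ z ∈ mapF '' Icc (dot a) (dot b), z ≤ dot (a - 1) := by
    obtain ⟨k, rfl | rfl⟩ := Int.even_or_odd' a
    · refine ⟨_, hmem _ le_rfl hab.le, dot_strictMono.monotone ?_⟩
      rw [dotMap_even]
      omega
    · refine ⟨_, hmem (2 * (k + 1)) (by omega) (by omega), dot_strictMono.monotone ?_⟩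
      rw [dotMap_even]
      omega
  have hhigh : ∃ z ∈ mapF '' Icc (dot a) (dot b), dot (b + 1) ≤ z := by
    obtain ⟨k, rfl | rfl⟩ := Int.even_or_odd' b
    · refine ⟨_, hmem (2 * (k - 1) + 1) (by omega) (by omega), dot_strictMono.monotone ?_⟩
      rw [dotMap_odd]
      omega
    · refine ⟨_, hmem _ hab.le le_rfl, dot_strictMono.monotone ?_⟩
      rw [dotMap_odd]
      omega
  obtain ⟨z, hz, hz'⟩ := hlow
  obtain ⟨w, hw, hw'⟩ := hhigh
  exact (Icc_subset_Icc hz' hw').trans (hpre.Icc_subset hz hw)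

theorem exists_param_mem {U : Set (Icc (0 : ℝ) 1)} (hU : IsOpen U) (hne : U.Nonempty) :
    ∃ y, param h y ∈ U := by
  obtain ⟨a, b, hab, hsub⟩ := hU.exists_Ioo_subset hne
  obtain ⟨c, hac, hcb⟩ := exists_between hab
  rcases eq_zero_or_one_or_param h c with rfl | rfl | ⟨y, rfl⟩
  · exact absurd (show (0 : Icc (0 : ℝ) 1) ≤ a from a.2.1) (not_le.2 hac)
  · exact absurd (show b ≤ (1 : Icc (0 : ℝ) 1) from b.2.2) (not_le.2 hcb)
  · exact ⟨y, hsub ⟨hac, hcb⟩⟩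

variable (h) in
-- By expansion some iterate of `U` covers a piece. Each further iterate covers one more piece on
-- both sides, so from some time on every iterate contains a given point of `V`.
theorem isTopologicallyMixing_mapf : IsTopologicallyMixing (mapf h) := by
  intro U V hU hUne hV hVne
  obtain ⟨v, hv⟩ := exists_param_mem (h := h) hV hVne
  obtain ⟨u, hu⟩ := exists_param_mem (h := h) hU hUne
  obtain ⟨p, q, hpq, hsub⟩ := (hU.preimage (continuous_param h)).exists_Ioo_subset ⟨u, hu⟩
  obtain ⟨p', h1, h2⟩ := exists_between hpq
  obtain ⟨q', h3, h4⟩ := exists_between h2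
  have himage : ∀ (n : ℕ) (S : Set ℝ), (∀ y ∈ S, param h y ∈ (mapf h)^[n] '' U) →
      ∀ y ∈ mapF '' S, param h y ∈ (mapf h)^[n + 1] '' U := by
    rintro n S hS _ ⟨y, hy, rfl⟩
    obtain ⟨x, hx, hxy⟩ := hS y hy
    exact ⟨x, hx, by rw [Function.iterate_succ_apply', hxy, mapf_param]⟩
  have hex : ∃ j, ∃ n : ℕ, ∀ y ∈ Icc (dot j) (dot (j + 1)), param h y ∈ (mapf h)^[n] '' U := by
    refine exists_piece_of_expanding
      (fun p q => ∃ n : ℕ, ∀ y ∈ Icc p q, param h y ∈ (mapf h)^[n] '' U) ?_ ?_ h3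
      ⟨0, fun y hy => ⟨_, hsub ⟨h1.trans_le hy.1, hy.2.trans_lt h4⟩, rfl⟩⟩
    · rintro p q p' q' ⟨n, hn⟩ hp - hq
      exact ⟨n, fun y hy => hn y ⟨hp.trans hy.1, hy.2.trans hq⟩⟩
    · rintro p q j ⟨n, hn⟩ hpq - -
      refine ⟨n + 1, fun y hy => himage n _ hn y ?_⟩
      rw [← uIcc_of_le hpq.le]
      exact intermediate_value_uIcc continuous_mapF.continuousOn hy
  obtain ⟨j, n, hn⟩ := hex
  have hgrow : ∀ m : ℕ, ∀ y ∈ Icc (dot (j - m)) (dot (j + 1 + m)),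
      param h y ∈ (mapf h)^[n + m] '' U := by
    intro m
    induction m with
    | zero => simpa using hn
    | succ m ih =>
      intro y hy
      refine himage _ _ ih y (Icc_dot_subset_image (by omega) ?_)
      convert hy using 3 <;> push_cast <;> ring
  have hmem := mem_Icc_pieceIndex v
  refine ⟨n + (pieceIndex v - j).natAbs, fun N hN => ?_⟩
  obtain ⟨m, rfl⟩ := Nat.exists_eq_add_of_le hN
  refine ⟨param h v, ?_, hv⟩
  rw [add_assoc]
  refine hgrow _ v ⟨le_trans (dot_strictMono.monotone ?_) hmem.1,
    hmem.2.trans (dot_strictMono.monotone ?_)⟩ <;> omega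

/-! ### Conjugacy to maps of constant slope -/

/-- Extended by the endpoints, `φ ∘ h` is an increasing bijection onto `[a, b]`. It is thus an order
isomorphism, and so a homeomorphism for the order topologies. -/
theorem isConjugateToConstantSlope_of_hasSlope (hm : StrictMono h.symm) {φ : ℝ → ℝ} {lam : ℝ}
    {a b : EReal} (hlam : 0 ≤ lam) (hφ : StrictMono φ) (hs : HasSlope φ lam)
    (ha : ∀ x, a < (φ x : EReal)) (hb : ∀ x, (φ x : EReal) < b)
    (hsurj : ∀ y : ℝ, a < (y : EReal) → (y : EReal) < b → ∃ x, φ x = y) :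
    IsConjugateToConstantSlope (mapf h) a b lam := by
  classical
  have hp := param_strictMono hm
  have hab : a ≤ b := ((ha 0).trans (hb 0)).le
  let χ : Icc (0 : ℝ) 1 → Icc a b := fun x =>
    if hx : (x : ℝ) ∈ Ioo (0 : ℝ) 1 then ⟨φ (h ⟨x, hx⟩), (ha _).le, (hb _).le⟩
    else if x = 0 then ⟨a, left_mem_Icc.2 hab⟩ else ⟨b, right_mem_Icc.2 hab⟩
  have hχ0 : (χ 0 : EReal) = a := by simp [χ]
  have hχ1 : (χ 1 : EReal) = b := by simp [χ]
  have hχ : ∀ y, (χ (param h y) : EReal) = φ y := by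
    intro y
    have : ((param h y : Icc (0 : ℝ) 1) : ℝ) ∈ Ioo (0 : ℝ) 1 := (h.symm y).2
    simp only [χ, dif_pos this]
    simp [param]
  have hmono : StrictMono χ := by
    intro x y hxy
    rw [← Subtype.coe_lt_coe]
    rcases eq_zero_or_one_or_param h x with rfl | rfl | ⟨x, rfl⟩ <;>
      rcases eq_zero_or_one_or_param h y with rfl | rfl | ⟨y, rfl⟩
    · exact absurd hxy (lt_irrefl _)
    · rw [hχ0, hχ1]
      exact (ha 0).trans (hb 0)
    · rw [hχ0, hχ]
      exact ha y
    · exact absurd hxy (not_lt.2 zero_le_one)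
    · exact absurd hxy (lt_irrefl _)
    · exact absurd hxy (not_lt.2 (param_lt_one h y).le)
    · exact absurd hxy (not_lt.2 (param_pos h x).le)
    · rw [hχ1, hχ]
      exact hb x
    · rw [hχ, hχ, EReal.coe_lt_coe_iff]
      exact hφ (hp.lt_iff_lt.1 hxy)
  have hsur : Function.Surjective χ := by
    intro y
    rcases y.2.1.eq_or_lt with h0 | h0
    · exact ⟨0, Subtype.ext (hχ0.trans h0)⟩
    rcases y.2.2.eq_or_lt with h1 | h1
    · exact ⟨1, Subtype.ext (hχ1.trans h1.symm)⟩
    have hy : ((y : EReal).toReal : EReal) = y :=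
      EReal.coe_toReal (h1.trans_le le_top).ne (bot_le.trans_lt h0).ne'
    obtain ⟨x, hx⟩ := hsurj (y : EReal).toReal (by rwa [hy]) (by rwa [hy])
    exact ⟨param h x, Subtype.ext (by rw [hχ, hx, hy])⟩
  let ψ : Icc (0 : ℝ) 1 ≃ₜ Icc a b := (hmono.orderIsoOfSurjective χ hsur).toHomeomorph
  have hψχ : ⇑ψ = χ := rfl
  refine ⟨ψ, fun y => ψ (mapf h (ψ.symm y)), hmono, fun x => ?_, ψ '' partitionP h,
    (isCPMM_mapf hm).conj ψ hmono, fun I hI => ?_⟩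
  · simp only [ψ.symm_apply_apply]
  obtain ⟨_, hI', rfl⟩ := exists_of_mem_basicIntervals_image ψ hI
  rw [basicIntervals_partitionP] at hI'
  obtain ⟨j, rfl⟩ := hI'
  obtain ⟨c, hc⟩ := hs j
  refine ⟨slopeSign j * lam, c, by rw [abs_mul, abs_slopeSign, one_mul, abs_of_nonneg hlam], ?_⟩
  rintro _ ⟨_, ⟨y, hy, rfl⟩, rfl⟩
  simp only [ψ.symm_apply_apply]
  rw [mapf_param, hψχ, hχ, hχ, EReal.toReal_coe,
    hc y (Ioo_subset_Icc_self hy)]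

theorem isConjugateToConstantSlope_real (hm : StrictMono h.symm) {lam : ℝ} (hlam : 2 + √5 ≤ lam) :
    IsConjugateToConstantSlope (mapf h) ⊥ ⊤ lam := by
  obtain ⟨φ, -, hφ, hs, hsurj⟩ := exists_hasSlope_real hlam
  exact isConjugateToConstantSlope_of_hasSlope hm (by linarith [two_lt_sqrt_five]) hφ hs
    (fun _ => EReal.bot_lt_coe _) (fun _ => EReal.coe_lt_top _) fun y _ _ => hsurj y

theorem isConjugateToConstantSlope_Ici (hm : StrictMono h.symm) {lam : ℝ} (hlam : 2 + √5 < lam)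
    (a : ℝ) : IsConjugateToConstantSlope (mapf h) a ⊤ lam := by
  obtain ⟨φ, -, hφ, hs, hpos, hsurj⟩ := exists_hasSlope_pos hlam
  refine isConjugateToConstantSlope_of_hasSlope hm (φ := fun x => φ x + a)
    (by linarith [two_lt_sqrt_five]) (fun x y hxy => by linarith [hφ hxy]) (hs.add_const a)
    (fun x => EReal.coe_lt_coe_iff.2 (by linarith [hpos x])) (fun _ => EReal.coe_lt_top _)
    fun y hy _ => ?_
  obtain ⟨x, hx⟩ := hsurj (y - a) (sub_pos.2 (EReal.coe_lt_coe_iff.1 hy))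
  exact ⟨x, by rw [hx]; ring⟩

theorem isConjugateToConstantSlope_Iic (hm : StrictMono h.symm) {lam : ℝ} (hlam : 2 + √5 < lam)
    (a : ℝ) : IsConjugateToConstantSlope (mapf h) ⊥ a lam := by
  obtain ⟨φ, -, hφ, hs, hpos, hsurj⟩ := exists_hasSlope_pos hlam
  refine isConjugateToConstantSlope_of_hasSlope hm (φ := fun x => -φ (dotB - x) + a)
    (by linarith [two_lt_sqrt_five]) (fun x y hxy => by linarith [strictMono_reflect hφ hxy])
    (hs.reflect.add_const a) (fun _ => EReal.bot_lt_coe _)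
    (fun x => EReal.coe_lt_coe_iff.2 (by linarith [hpos (dotB - x)])) fun y _ hy => ?_
  obtain ⟨x, hx⟩ := hsurj (a - y) (sub_pos.2 (EReal.coe_lt_coe_iff.1 hy))
  exact ⟨dotB - x, by simp only [sub_sub_cancel, hx]; ring⟩

/-! ### Orientation -/

theorem mapf_trans_subLeft : mapf (h.trans (Homeomorph.subLeft dotB)) = mapf h := by
  funext x
  rw [mapf, mapf]
  split_ifs with hx
  · refine Subtype.ext ?_
    simp [mapF_reflect]
  · rfl

theorem partitionP_trans_subLeft :
    partitionP (h.trans (Homeomorph.subLeft dotB)) = partitionP h := by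
  have hpar : ∀ y, param (h.trans (Homeomorph.subLeft dotB)) y = param h (dotB - y) := by
    intro y
    simp [param, neg_add_eq_sub]
  ext x
  rw [mem_partitionP_iff, mem_partitionP_iff]
  refine or_congr_right (or_congr_right ⟨?_, ?_⟩) <;> rintro ⟨j, rfl⟩ <;> refine ⟨1 - j, ?_⟩
  · rw [hpar, dot_reflect]
  · rw [hpar, dot_reflect, sub_sub_cancel]

/-- Up to a reflection of the real line, the homeomorphism is increasing. -/
theorem exists_strictMono_symm (h : Ioo (0 : ℝ) 1 ≃ₜ ℝ) :
    ∃ h' : Ioo (0 : ℝ) 1 ≃ₜ ℝ, StrictMono h'.symm ∧ mapf h' = mapf h ∧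
      partitionP h' = partitionP h := by
  rcases h.symm.continuous.strictMono_of_inj h.symm.injective with hm | hm
  · exact ⟨h, hm, rfl, rfl⟩
  · refine ⟨h.trans (Homeomorph.subLeft dotB), fun x y hxy => ?_, mapf_trans_subLeft,
      partitionP_trans_subLeft⟩
    have hs : ∀ y, (h.trans (Homeomorph.subLeft dotB)).symm y = h.symm (dotB - y) := by
      intro y
      simp [neg_add_eq_sub]
    rw [hs, hs]
    exact hm (sub_lt_sub_left hxy _)

end

/-! ### Eigenvectors -/

/-- The indices of the basic intervals covered by the image of a basic interval. -/
def window (i : ℤ) : Finset ℤ :=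
  if Even i then {i - 2, i - 1, i, i + 1, i + 2} else {i - 1, i, i + 1}

theorem sum_window_even (u : ℤ → ℝ) (k : ℤ) : ∑ j ∈ window (2 * k), u j =
    u (2 * (k - 1)) + u (2 * (k - 1) + 1) + u (2 * k) + u (2 * k + 1) + u (2 * (k + 1)) := by
  rw [window, if_pos (by simp)]
  repeat rw [Finset.sum_insert (by simp <;> omega)]
  rw [Finset.sum_singleton, show 2 * k - 2 = 2 * (k - 1) by ring,
    show 2 * k - 1 = 2 * (k - 1) + 1 by ring, show 2 * k + 2 = 2 * (k + 1) by ring]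
  ring

theorem sum_window_odd (u : ℤ → ℝ) (k : ℤ) : ∑ j ∈ window (2 * k + 1), u j =
    u (2 * k) + u (2 * k + 1) + u (2 * (k + 1)) := by
  rw [window, if_neg (by simp)]
  repeat rw [Finset.sum_insert (by simp <;> omega)]
  rw [Finset.sum_singleton, show 2 * k + 1 - 1 = 2 * k by ring,
    show 2 * k + 1 + 1 = 2 * (k + 1) by ring]
  ring

theorem mapF_image_Ioo (i : ℤ) : mapF '' Ioo (dot i) (dot (i + 1)) =
    Ioo (dot (min (dotMap i) (dotMap (i + 1)))) (dot (max (dotMap i) (dotMap (i + 1)))) := by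
  have hlt := dot_strictMono (lt_add_one i)
  have hpos : (0 : ℝ) < 2 + √5 := by positivity
  have hleft := mapF_dot i
  have hright := mapF_dot (i + 1)
  have hmono : ∀ x ∈ Icc (dot i) (dot (i + 1)), ∀ y ∈ Icc (dot i) (dot (i + 1)), x < y →
      slopeSign i * mapF x < slopeSign i * mapF y := by
    intro x hx y hy hxy
    rw [mapF_piece hx, mapF_piece hy]
    have h : 0 < (slopeSign i * slopeSign i) * ((2 + √5) * (y - x)) := by
      have := sub_pos.2 hxy
      rw [slopeSign_mul_self]
      positivity
    linarith
  have hl : dot i ∈ Icc (dot i) (dot (i + 1)) := left_mem_Icc.2 hlt.le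
  have hr : dot (i + 1) ∈ Icc (dot i) (dot (i + 1)) := right_mem_Icc.2 hlt.le
  unfold slopeSign at hmono
  split_ifs at hmono with hi
  · have hle : dotMap i ≤ dotMap (i + 1) := dot_strictMono.le_iff_le.1 (by
      have := hmono _ hl _ hr hlt
      rw [← hleft, ← hright]
      linarith)
    rw [min_eq_left hle, max_eq_right hle, ← hleft, ← hright]
    refine Subset.antisymm ?_ (intermediate_value_Ioo hlt.le continuous_mapF.continuousOn)
    rintro _ ⟨x, hx, rfl⟩
    have h1 := hmono _ hl x (Ioo_subset_Icc_self hx) hx.1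
    have h2 := hmono x (Ioo_subset_Icc_self hx) _ hr hx.2
    constructor <;> linarith
  · have hle : dotMap (i + 1) ≤ dotMap i := dot_strictMono.le_iff_le.1 (by
      have := hmono _ hl _ hr hlt
      rw [← hleft, ← hright]
      linarith)
    rw [min_eq_right hle, max_eq_left hle, ← hleft, ← hright]
    refine Subset.antisymm ?_ (intermediate_value_Ioo' hlt.le continuous_mapF.continuousOn)
    rintro _ ⟨x, hx, rfl⟩
    have h1 := hmono _ hl x (Ioo_subset_Icc_self hx) hx.1
    have h2 := hmono x (Ioo_subset_Icc_self hx) _ hr hx.2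
    constructor <;> linarith

section

variable (h : Ioo (0 : ℝ) 1 ≃ₜ ℝ)

theorem cell_subset_image_iff (i j : ℤ) :
    cell h j ⊆ mapf h '' cell h i ↔ j ∈ window i := by
  have h1 : mapf h '' cell h i = param h '' (mapF '' Ioo (dot i) (dot (i + 1))) := by
    rw [cell, image_image, image_image]
    simp only [mapf_param]
  rw [h1, cell, image_subset_image_iff (param_injective h), mapF_image_Ioo,
    Ioo_subset_Ioo_iff (dot_strictMono (lt_add_one j)), dot_strictMono.le_iff_le,
    dot_strictMono.le_iff_le]
  obtain ⟨k, rfl | rfl⟩ := Int.even_or_odd' i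
  · rw [dotMap_even, dotMap_odd, window, if_pos (by simp)]
    simp only [Finset.mem_insert, Finset.mem_singleton]
    omega
  · rw [show 2 * k + 1 + 1 = 2 * (k + 1) by ring, dotMap_even, dotMap_odd, window,
      if_neg (by simp)]
    simp only [Finset.mem_insert, Finset.mem_singleton]
    omega

/-- The enumeration of the basic intervals. -/
noncomputable def cellEquiv : ℤ ≃ basicIntervals (partitionP h) :=
  Equiv.ofBijective
    (fun j => ⟨cell h j, by rw [basicIntervals_partitionP]; exact mem_range_self j⟩)
    ⟨fun i j hij => by
      by_contra hne
      have h1 := disjoint_cell h hne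
      have h2 : cell h i = cell h j := congrArg Subtype.val hij
      rw [h2, disjoint_self] at h1
      exact (cell_nonempty h j).ne_empty h1,
    fun I => by
      have hI : (I : Set (Icc (0 : ℝ) 1)) ∈ range (cell h) :=
        basicIntervals_partitionP h ▸ I.2
      obtain ⟨j, hj⟩ := hI
      exact ⟨j, Subtype.ext hj⟩⟩

theorem transitionMatrix_cellEquiv (i j : ℤ) :
    transitionMatrix (mapf h) (partitionP h) (cellEquiv h i) (cellEquiv h j) =
      if j ∈ window i then 1 else 0 := by
  classical
  unfold transitionMatrix
  exact if_congr (cell_subset_image_iff h i j) rfl rfl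

/-- Rows have at most five nonzero entries, so the series are finite sums and convergence is
automatic. -/
theorem isNonnegEigenvector_iff (lam : ℝ) (v : basicIntervals (partitionP h) → ℝ) :
    IsNonnegEigenvector (transitionMatrix (mapf h) (partitionP h)) lam v ↔
      v ∘ cellEquiv h ≠ 0 ∧ (∀ i, 0 ≤ v (cellEquiv h i)) ∧
        ∀ i, ∑ j ∈ window i, v (cellEquiv h j) = lam * v (cellEquiv h i) := by
  have hsum : ∀ i, HasSum (fun j => transitionMatrix (mapf h) (partitionP h) (cellEquiv h i) j *
      v j) (∑ j ∈ window i, v (cellEquiv h j)) := by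
    intro i
    rw [← (cellEquiv h).hasSum_iff]
    have := hasSum_sum_of_ne_finset_zero (L := .unconditional ℤ) (s := window i)
      (f := fun j => if j ∈ window i then v (cellEquiv h j) else 0) fun j hj => if_neg hj
    rw [Finset.sum_congr rfl fun j hj => if_pos hj] at this
    convert this using 2 with j
    rw [Function.comp_apply, transitionMatrix_cellEquiv, ite_mul, one_mul, zero_mul]
  constructor
  · intro hv
    refine ⟨fun h0 => hv.ne_zero ?_, fun i => hv.nonneg _, fun i => (hsum i).unique (hv.eigen _)⟩
    funext I
    obtain ⟨i, rfl⟩ := (cellEquiv h).surjective I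
    exact congrFun h0 i
  · rintro ⟨h1, h2, h3⟩
    refine ⟨fun h0 => h1 (by rw [h0]; rfl), fun I => ?_, fun I => ?_⟩
    · obtain ⟨i, rfl⟩ := (cellEquiv h).surjective I
      exact h2 i
    · obtain ⟨i, rfl⟩ := (cellEquiv h).surjective I
      rw [← h3]
      exact hsum i

end

/-- `window i` lists the cells between the dots `dotMap i` and `dotMap (i + 1)`, so the sum
telescopes. -/
theorem IsDotSequence.sum_window {lam : ℝ} {D : ℤ → ℝ} (hD : IsDotSequence lam D) (i : ℤ) :
    ∑ j ∈ window i, (D (j + 1) - D j) = lam * (D (i + 1) - D i) := by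
  have h := hD.eq i
  obtain ⟨k, rfl | rfl⟩ := Int.even_or_odd' i
  · rw [dotMap_even, dotMap_odd, slopeSign_even] at h
    rw [sum_window_even, show 2 * (k - 1) + 1 + 1 = 2 * k by ring,
      show 2 * k + 1 + 1 = 2 * (k + 1) by ring]
    linarith
  · rw [show 2 * k + 1 + 1 = 2 * (k + 1) by ring, dotMap_even, dotMap_odd, slopeSign_odd,
      show k + 1 - 1 = k by ring] at h
    rw [sum_window_odd, show 2 * k + 1 + 1 = 2 * (k + 1) by ring]
    linarith

theorem exists_isDotSequence {lam : ℝ} (h : 2 + √5 ≤ lam) : ∃ D, IsDotSequence lam D := by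
  rcases h.eq_or_lt with rfl | h
  · exact ⟨dot, isDotSequence_dot⟩
  · obtain ⟨t, ht, -, hteq⟩ := exists_ratio h
    exact ⟨_, isDotSequence_geomDot (by linarith [two_lt_sqrt_five]) ht hteq⟩

/-- The even entries of a nonnegative eigenvector are positive and satisfy a linear recurrence. -/
theorem even_recurrence {lam : ℝ} {u : ℤ → ℝ} (hne : u ≠ 0) (hnn : ∀ i, 0 ≤ u i)
    (heig : ∀ i, ∑ j ∈ window i, u j = lam * u i) :
    0 < lam ∧ (∀ k, 0 < u (2 * k)) ∧ ∀ k, lam * (u (2 * (k + 1)) + u (2 * (k - 1))) =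
      (lam * lam - 2 * lam - 1) * u (2 * k) := by
  have he : ∀ k, u (2 * (k - 1)) + u (2 * (k - 1) + 1) + u (2 * k) + u (2 * k + 1) +
      u (2 * (k + 1)) = lam * u (2 * k) := fun k => by rw [← heig, sum_window_even]
  have ho : ∀ k, u (2 * k) + u (2 * k + 1) + u (2 * (k + 1)) = lam * u (2 * k + 1) := fun k => by
    rw [← heig, sum_window_odd]
  have hex : ∃ k, 0 < u (2 * k) := by
    by_contra! hle
    have hx : ∀ k, u (2 * k) = 0 := fun k => le_antisymm (hle k) (hnn _)
    refine hne (funext fun i => ?_)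
    obtain ⟨k, rfl | rfl⟩ := Int.even_or_odd' i
    · exact hx k
    · have h1 := he k
      rw [hx, hx, hx] at h1
      have h2 : u (2 * k + 1) = 0 :=
        le_antisymm (by linarith [hnn (2 * (k - 1) + 1)]) (hnn _)
      exact h2
  obtain ⟨k₀, hk₀⟩ := hex
  have hlam : 0 < lam := by
    refine pos_of_mul_pos_left (b := u (2 * k₀)) ?_ hk₀.le
    rw [← he k₀]
    linarith [hnn (2 * (k₀ - 1)), hnn (2 * (k₀ - 1) + 1), hnn (2 * k₀ + 1), hnn (2 * (k₀ + 1))]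
  -- The row of an even index contains both neighbouring even indices, so positivity spreads in both
  -- directions.
  have hup : ∀ k, 0 < u (2 * k) → 0 < u (2 * (k + 1)) := fun k hk => by
    refine pos_of_mul_pos_right (a := lam) ?_ hlam.le
    have h1 := he (k + 1)
    rw [add_sub_cancel_right] at h1
    linarith [hnn (2 * k + 1), hnn (2 * (k + 1)), hnn (2 * (k + 1) + 1), hnn (2 * (k + 1 + 1))]
  have hdown : ∀ k, 0 < u (2 * k) → 0 < u (2 * (k - 1)) := fun k hk => by
    refine pos_of_mul_pos_right (a := lam) ?_ hlam.le
    have h1 := he (k - 1)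
    rw [sub_add_cancel] at h1
    linarith [hnn (2 * (k - 1 - 1)), hnn (2 * (k - 1 - 1) + 1), hnn (2 * (k - 1)),
      hnn (2 * (k - 1) + 1)]
  refine ⟨hlam, fun k => Int.inductionOn' k k₀ hk₀ (fun k _ => hup k) fun k _ => hdown k,
    fun k => ?_⟩
  have h1 := he k
  have h2 := ho k
  have h3 := ho (k - 1)
  rw [sub_add_cancel] at h3
  -- The odd rows read `(lam - 1) * u (2k + 1) = u (2k) + u (2k + 2)`; multiplying the even row by
  -- `lam - 1` eliminates the odd entries without division.
  linear_combination (lam - 1) * h1 + h2 + h3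

/-- Below the threshold the recurrence is `x (k + 1) + x (k - 1) = s * x k` with `s < 2`. Since `r +
1 / r ≥ 2` for `r > 0`, the ratios of successive terms drop by at least `2 - s` each time and would
become negative. -/
theorem sqrt_five_le_of_recurrence {lam : ℝ} {x : ℤ → ℝ} (hlam : 0 < lam) (hx : ∀ k, 0 < x k)
    (hrec : ∀ k, lam * (x (k + 1) + x (k - 1)) = (lam * lam - 2 * lam - 1) * x k) :
    2 + √5 ≤ lam := by
  by_contra! hlt
  have h5 : √5 * √5 = 5 := Real.mul_self_sqrt (by norm_num)
  obtain ⟨s, hs⟩ : ∃ s, s = (lam * lam - 2 * lam - 1) / lam := ⟨_, rfl⟩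
  have hs2 : s < 2 := by
    rw [hs, div_lt_iff₀ hlam]
    nlinarith [two_lt_sqrt_five]
  have hrec' : ∀ k, x (k + 1) + x (k - 1) = s * x k := fun k => by
    rw [hs, div_mul_eq_mul_div, ← hrec, mul_div_cancel_left₀ _ hlam.ne']
  have hstep : ∀ k, x (k + 1) / x k ≤ x k / x (k - 1) - (2 - s) := by
    intro k
    have h1 := hx k
    have h2 := hx (k - 1)
    rw [eq_sub_of_add_eq (hrec' k), sub_div, mul_div_cancel_right₀ _ h1.ne']
    have h3 : 2 ≤ x k / x (k - 1) + x (k - 1) / x k := by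
      rw [div_add_div _ _ h2.ne' h1.ne', le_div_iff₀ (by positivity)]
      nlinarith [sq_nonneg (x k - x (k - 1))]
    linarith
  have hiter : ∀ n : ℕ, x (n + 1) / x n ≤ x 1 / x 0 - n * (2 - s) := by
    intro n
    induction n with
    | zero => simp
    | succ n ih =>
      have h1 := hstep (n + 1)
      rw [add_sub_cancel_right] at h1
      push_cast
      linarith
  obtain ⟨n, hn⟩ := exists_nat_gt (x 1 / x 0 / (2 - s))
  rw [div_lt_iff₀ (by linarith)] at hn
  have h1 := hiter n
  have h2 : 0 < x (n + 1) / x n := div_pos (hx _) (hx _)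
  linarith

/-- The increments are monotone, so according to the sign of the one at `0` the sequence stays above
`x 0 > 0` on the right or on the left. Its terms then do not tend to zero. -/
theorem not_summable_of_convex {x : ℤ → ℝ} (hx : ∀ k, 0 < x k)
    (hconv : ∀ k, 2 * x k ≤ x (k + 1) + x (k - 1)) : ¬ Summable x := by
  intro hs
  have hmono : Monotone fun k => x (k + 1) - x k := monotone_int_of_le_succ fun k => by
    have := hconv (k + 1)
    rw [add_sub_cancel_right] at this
    linarith
  have hcof := hs.tendsto_cofinite_zero
  have hev : ∀ e : ℕ → ℤ, Function.Injective e → ∃ n, x (e n) < x 0 := fun e he => by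
    have h1 := hcof.comp he.tendsto_cofinite
    rw [Nat.cofinite_eq_atTop] at h1
    exact (h1.eventually_lt_const (hx 0)).exists
  rcases le_total 0 (x (0 + 1) - x 0) with h0 | h0
  · obtain ⟨n, hn⟩ := hev (fun n => (n : ℤ)) Nat.cast_injective
    refine not_le.2 hn ?_
    clear hn
    induction n with
    | zero => simp
    | succ n ih =>
      have := hmono (show (0 : ℤ) ≤ n by positivity)
      simp only at this
      push_cast
      linarith
  · obtain ⟨n, hn⟩ := hev (fun n => -(n : ℤ)) (neg_injective.comp Nat.cast_injective)
    refine not_le.2 hn ?_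
    clear hn
    induction n with
    | zero => simp
    | succ n ih =>
      have := hmono (show -((n + 1 : ℕ) : ℤ) ≤ 0 by omega)
      simp only at this
      rw [show -((n + 1 : ℕ) : ℤ) + 1 = -n by push_cast; ring] at this
      linarith

theorem exists_isNonnegEigenvector_iff (h : Ioo (0 : ℝ) 1 ≃ₜ ℝ) (lam : ℝ) :
    (∃ v, IsNonnegEigenvector (transitionMatrix (mapf h) (partitionP h)) lam v) ↔
      2 + √5 ≤ lam := by
  constructor
  · rintro ⟨v, hv⟩
    obtain ⟨h1, h2, h3⟩ := (isNonnegEigenvector_iff h lam v).1 hv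
    obtain ⟨h4, h5, h6⟩ := even_recurrence h1 h2 h3
    exact sqrt_five_le_of_recurrence h4 h5 h6
  · intro hlam
    obtain ⟨D, hD⟩ := exists_isDotSequence hlam
    have hpos : ∀ j, 0 < D (j + 1) - D j := fun j => sub_pos.2 (hD.strictMono (lt_add_one j))
    refine ⟨fun I => D ((cellEquiv h).symm I + 1) - D ((cellEquiv h).symm I),
      (isNonnegEigenvector_iff h lam _).2 ⟨fun h0 => ?_, fun i => ?_, fun i => ?_⟩⟩
    · have := congrFun h0 0
      simp only [Function.comp_apply, Equiv.symm_apply_apply] at this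
      exact (hpos 0).ne' this
    · exact (hpos _).le
    · simp only [Equiv.symm_apply_apply]
      exact hD.sum_window i

theorem IsNonnegEigenvector.not_summable {h : Ioo (0 : ℝ) 1 ≃ₜ ℝ} {lam : ℝ}
    {v : basicIntervals (partitionP h) → ℝ}
    (hv : IsNonnegEigenvector (transitionMatrix (mapf h) (partitionP h)) lam v) :
    ¬ Summable v := by
  intro hs
  have hlam := (exists_isNonnegEigenvector_iff h lam).1 ⟨v, hv⟩
  obtain ⟨h1, h2, h3⟩ := (isNonnegEigenvector_iff h lam v).1 hv
  obtain ⟨h4, h5, h6⟩ := even_recurrence h1 h2 h3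
  refine not_summable_of_convex h5 (fun k => ?_) (((cellEquiv h).summable_iff.2 hs).comp_injective
    (i := fun k : ℤ => 2 * k) fun a b hab => by simpa using hab)
  have hsq : √5 * √5 = 5 := Real.mul_self_sqrt (by norm_num)
  -- This inequality, equivalent to the eigenvalue bound for positive `lam`, makes the even entries
  -- convex.
  have h7 : 2 * lam ≤ lam * lam - 2 * lam - 1 := by nlinarith [two_lt_sqrt_five]
  refine le_of_mul_le_mul_left ?_ h4
  rw [h6 k]
  nlinarith [h5 k]

end ConstantSlope

theorem mainTheorem5 :
    -- `F` has constant slope `2 + √5` on each interval between consecutive dots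
    (∀ k : ℤ,
      (∀ x ∈ Set.Icc (k : ℝ) (k + ConstantSlope.dotB),
        ConstantSlope.mapF x = k - 1 + (2 + √5) * (x - k)) ∧
      (∀ x ∈ Set.Icc ((k : ℝ) + ConstantSlope.dotB) (k + 1),
        ConstantSlope.mapF x =
          k + ConstantSlope.dotB + 1 - (2 + √5) * (x - (k + ConstantSlope.dotB)))) ∧
    ∀ h : Set.Ioo (0 : ℝ) 1 ≃ₜ ℝ,
      ConstantSlope.IsCPMM (ConstantSlope.mapf h) (ConstantSlope.partitionP h) ∧
      ConstantSlope.IsTopologicallyMixing (ConstantSlope.mapf h) ∧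
      (∀ lam : ℝ,
        (∃ v, ConstantSlope.IsNonnegEigenvector
          (ConstantSlope.transitionMatrix (ConstantSlope.mapf h) (ConstantSlope.partitionP h))
          lam v) ↔ 2 + √5 ≤ lam) ∧
      (∀ (lam : ℝ) (v : ConstantSlope.basicIntervals (ConstantSlope.partitionP h) → ℝ),
        ConstantSlope.IsNonnegEigenvector
          (ConstantSlope.transitionMatrix (ConstantSlope.mapf h) (ConstantSlope.partitionP h))
          lam v → ¬ Summable v) ∧
      (∀ lam : ℝ, 2 + √5 ≤ lam →
        ConstantSlope.IsConjugateToConstantSlope (ConstantSlope.mapf h) ⊥ ⊤ lam) ∧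
      (∀ lam : ℝ, 2 + √5 < lam → ∀ a : ℝ,
        ConstantSlope.IsConjugateToConstantSlope (ConstantSlope.mapf h) (a : EReal) ⊤ lam ∧
        ConstantSlope.IsConjugateToConstantSlope (ConstantSlope.mapf h) ⊥ (a : EReal) lam) := by
  refine ⟨fun k => ⟨fun x hx => ConstantSlope.mapF_left hx,
    fun x hx => ConstantSlope.mapF_right hx⟩, fun h => ?_⟩
  -- A decreasing `h` may be composed with the reflection, which changes neither `f` nor `P`.
  obtain ⟨h', hm, hf, hP⟩ := ConstantSlope.exists_strictMono_symm h
  refine ⟨?_, ConstantSlope.isTopologicallyMixing_mapf h,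
    ConstantSlope.exists_isNonnegEigenvector_iff h, fun lam v hv => hv.not_summable, ?_, ?_⟩
  · rw [← hf, ← hP]
    exact ConstantSlope.isCPMM_mapf hm
  · intro lam hlam
    rw [← hf]
    exact ConstantSlope.isConjugateToConstantSlope_real hm hlam
  · intro lam hlam a
    rw [← hf]
    exact ⟨ConstantSlope.isConjugateToConstantSlope_Ici hm hlam a,
      ConstantSlope.isConjugateToConstantSlope_Iic hm hlam a⟩
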